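/- Let $\mathbb{K}$ be a field and $V=\mathbb{K}^3$. An arrangement in $V$ is a finite set $\mathcal{A}$ of two-dimensional linear subspaces (planes) of $V$. Let $L(\mathcal{A})$ be the set of all intersections of subsets of $\mathcal{A}$ (the empty intersection being $V$), define $\mu:L(\mathcal{A})\to\mathbb{Z}$ by $\mu(V)=1$ and $\mu(X)=-\sum_{Y\in L(\mathcal{A}),\,X\subsetneq Y}\mu(Y)$ for $X\ne V$, and put $$\chi(\mathcal{A};t)=\sum_{X\in L(\mathcal{A})}\mu(X)\,t^{\dim X}.$$ For $\mathcal{A}\neq\emptyset$ this polynomial is divisible by $t-1$, and $\chi_0(\mathcal{A};t)=\chi(\mathcal{A};t)/(t-1)$. Call $\mathcal{A}$ integer-rooted if $\chi(\mathcal{A};t)$ has three integer roots, counted with multiplicity. Let $S=\mathbb{K}[x_1,x_2,x_3]$, let $\alpha_H$ be a linear form with kernel $H$ for $H\in\mathcal{A}$, and let $$D(\mathcal{A})=\{\theta\in\operatorname{Der}_{\mathbb{K}}(S)\mid \theta(\alpha_H)\in S\alpha_H\text{ for all }H\in\mathcal{A}\}.$$ $\mathcal{A}$ is free with exponents $(d_1,d_2,d_3)$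 if $D(\mathcal{A})$ is a free $S$-module with a basis $\theta_1,\theta_2,\theta_3$ such that $\theta_i$ is homogeneous of degree $d_i$, i.e. each $\theta_i(x_j)$ is zero or a homogeneous polynomial of degree $d_i$. **Theorem.** Let $\mathcal{A}$ be an arrangement in $\mathbb{K}^3$, let $H\in\mathcal{A}$ and $\mathcal{A}'=\mathcal{A}\setminus\{H\}$. Assume that $\mathcal{A}$ and $\mathcal{A}'$ are both integer-rooted. 1. If $\mathcal{A}$ is free with exponents $(1,a,b)$, $a\le b$, and $\mathcal{A}'\ne\emptyset$ has $\chi_0(\mathcal{A}';t)=(t-c)(t-d)$ with integers $c\le d$, then $a-1\le c\le d\le b$. 2. If $\mathcal{A}'$ is free with exponents $(1,a,b)$, $a\le b$, and $\chi_0(\mathcal{A};t)=(t-c)(t-d)$ with integers $c\le d$, then $a\le c\le d\le b+1$. -/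

import Mathlib

open Polynomial

/-- A (central) arrangement in `K^ℓ`: a finite set of linear hyperplanes,
i.e. of linear subspaces of codimension one. -/
structure HypArrangement (K : Type*) [Field K] (ℓ : ℕ) where
  /-- the hyperplanes of the arrangement -/
  planes : Finset (Submodule K (Fin ℓ → K))
  /-- every member has codimension one -/
  codim_one : ∀ H ∈ planes, Module.finrank K H + 1 = ℓ

namespace HypArrangement

variable {K : Type*} [Field K] {ℓ : ℕ}

open Classical in
/-- The deletion `A ∖ {H}`. -/
noncomputable def delete (A : HypArrangement K ℓ) (H : Submodule K (Fin ℓ → K)) :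
    HypArrangement K ℓ where
  planes := A.planes.erase H
  codim_one := fun L hL => A.codim_one L (Finset.mem_of_mem_erase hL)

open Classical in
/-- The intersection lattice `L(A)`: all intersections of subsets of `A`
(the empty intersection is the whole space `⊤`). -/
noncomputable def lattice (A : HypArrangement K ℓ) : Finset (Submodule K (Fin ℓ → K)) :=
  A.planes.powerset.image (fun B => B.inf id)

open Classical in
/-- The Möbius function: `μ(V) = 1` and `μ(X) = - ∑ μ(Y)` over all `Y ∈ L(A)` with `X ⊊ Y`. -/
noncomputable def moebius (A : HypArrangement K ℓ) (X : Submodule K (Fin ℓ → K)) : ℤ :=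
  if X = ⊤ then 1
  else - ∑ Y ∈ (A.lattice.filter (fun Y => X < Y)).attach, A.moebius Y.1
termination_by ℓ - Module.finrank K X
decreasing_by
  have h1 : X < Y.1 := (Finset.mem_filter.mp Y.2).2
  have h2 := Submodule.finrank_lt_finrank_of_lt h1
  have h3 := Submodule.finrank_le Y.1
  rw [Module.finrank_fin_fun] at h3
  omega

theorem moebius_top (A : HypArrangement K ℓ) : A.moebius ⊤ = 1 := by
  rw [moebius, if_pos rfl]

open Classical in
theorem moebius_of_ne_top (A : HypArrangement K ℓ) {X : Submodule K (Fin ℓ → K)} (hX : X ≠ ⊤) :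
    A.moebius X = - ∑ Y ∈ A.lattice.filter (fun Y => X < Y), A.moebius Y := by
  rw [moebius, if_neg hX, Finset.sum_attach _ (fun Y => A.moebius Y)]

/-- The characteristic polynomial `χ(A; t) = ∑_{X ∈ L(A)} μ(X) t^{dim X}`. -/
noncomputable def charPoly (A : HypArrangement K ℓ) : ℤ[X] :=
  ∑ Y ∈ A.lattice, C (A.moebius Y) * X ^ Module.finrank K Y

/-- The reduced characteristic polynomial `χ₀(A; t) = χ(A; t) / (t - 1)`. -/
noncomputable def charPoly₀ (A : HypArrangement K ℓ) : ℤ[X] :=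
  A.charPoly /ₘ (X - C 1)

/-- For a nonempty arrangement the division defining `χ₀` is exact. -/
theorem sub_one_mul_charPoly₀ (A : HypArrangement K ℓ) (hA : A.planes.Nonempty) :
    (X - C 1) * A.charPoly₀ = A.charPoly := by
  classical
  refine Polynomial.mul_divByMonic_eq_iff_isRoot.mpr ?_
  have hmem : A.planes.inf id ∈ A.lattice :=
    Finset.mem_image.mpr ⟨A.planes, Finset.mem_powerset_self _, rfl⟩
  have hne : A.planes.inf id ≠ ⊤ := by
    intro h
    obtain ⟨H, hH⟩ := hA
    have h1 : A.planes.inf id ≤ H := Finset.inf_le (f := id) hH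
    rw [h, top_le_iff] at h1
    have h2 := A.codim_one H hH
    rw [h1, finrank_top, Module.finrank_fin_fun] at h2
    omega
  have herase : A.lattice.filter (fun Y => A.planes.inf id < Y)
      = A.lattice.erase (A.planes.inf id) := by
    ext Y
    simp only [Finset.mem_filter, Finset.mem_erase]
    constructor
    · rintro ⟨h1, h2⟩
      exact ⟨h2.ne', h1⟩
    · rintro ⟨h1, h2⟩
      refine ⟨h2, lt_of_le_of_ne ?_ (Ne.symm h1)⟩
      obtain ⟨B, hB, rfl⟩ := Finset.mem_image.mp h2
      exact Finset.inf_mono (Finset.mem_powerset.mp hB)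
  have h := A.moebius_of_ne_top hne
  rw [herase] at h
  simp only [IsRoot, charPoly, eval_finsetSum, eval_mul, eval_C, eval_pow, eval_X, one_pow,
    mul_one]
  rw [← Finset.add_sum_erase _ _ hmem, h]
  ring

/-- `A` is integer rooted: `χ(A; t)` has `ℓ` integer roots, counted with multiplicity. -/
def IsIntegerRooted (A : HypArrangement K ℓ) : Prop :=
  ∃ r : Fin ℓ → ℤ, A.charPoly = ∏ i, (X - C (r i))

/-- A linear form on `K^ℓ`, as a polynomial in the coordinates `x_i`. -/
noncomputable def linPoly (α : Module.Dual K (Fin ℓ → K)) : MvPolynomial (Fin ℓ) K :=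
  ∑ i, MvPolynomial.C (α (Pi.single i 1)) * MvPolynomial.X i

/-- The value `θ(f)` of the derivation `θ = ∑ θ_i ∂_{x_i}` of `S = K[x_1, …, x_ℓ]`.
Here `Der S = ⊕ S ∂_{x_i}` is the free `S`-module of the coefficient vectors `(θ_1, …, θ_ℓ)`. -/
noncomputable def applyDer (θ : Fin ℓ → MvPolynomial (Fin ℓ) K) (f : MvPolynomial (Fin ℓ) K) :
    MvPolynomial (Fin ℓ) K :=
  ∑ i, θ i * MvPolynomial.pderiv i f

/-- `applyDer θ` is the `K`-derivation of `S` that sends `x_i` to `θ_i`. -/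
theorem applyDer_eq_mkDerivation (θ : Fin ℓ → MvPolynomial (Fin ℓ) K)
    (f : MvPolynomial (Fin ℓ) K) : applyDer θ f = MvPolynomial.mkDerivation K θ f := by
  have h : MvPolynomial.mkDerivation K θ = ∑ i, θ i • MvPolynomial.pderiv i := by
    refine MvPolynomial.derivation_ext fun j => ?_
    rw [MvPolynomial.mkDerivation_X, ← Derivation.coeFnAddMonoidHom_apply, map_sum]
    simp [Derivation.coeFnAddMonoidHom_apply, MvPolynomial.pderiv_X, Pi.single_apply]
  rw [h, ← Derivation.coeFnAddMonoidHom_apply, map_sum]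
  simp [Derivation.coeFnAddMonoidHom_apply, applyDer]

/-- The logarithmic derivation module
`D(A) = {θ ∈ Der S | θ(α_H) ∈ S α_H for all H ∈ A}`.
The defining form `α_H` is unique up to a nonzero scalar, and the condition is required for
each choice of it. -/
noncomputable def logDer (A : HypArrangement K ℓ) :
    Submodule (MvPolynomial (Fin ℓ) K) (Fin ℓ → MvPolynomial (Fin ℓ) K) where
  carrier := {θ | ∀ H ∈ A.planes, ∀ α : Module.Dual K (Fin ℓ → K), LinearMap.ker α = H →
    linPoly α ∣ applyDer θ (linPoly α)}
  add_mem' := fun {θ η} h1 h2 H hH α hα => by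
    have h : applyDer (θ + η) (linPoly α)
        = applyDer θ (linPoly α) + applyDer η (linPoly α) := by
      simp only [applyDer, Pi.add_apply, add_mul, Finset.sum_add_distrib]
    rw [h]
    exact dvd_add (h1 H hH α hα) (h2 H hH α hα)
  zero_mem' := fun H hH α hα => by
    simp [applyDer]
  smul_mem' := fun f θ h1 H hH α hα => by
    have h : applyDer (f • θ) (linPoly α) = f * applyDer θ (linPoly α) := by
      simp only [applyDer, Pi.smul_apply, smul_eq_mul, Finset.mul_sum, mul_assoc]
    rw [h]
    exact Dvd.dvd.mul_left (h1 H hH α hα) f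

/-- `A` is free with exponents `d_1, …, d_ℓ`: the `S`-module `D(A)` has a basis
`θ_1, …, θ_ℓ` of homogeneous derivations, with `deg θ_i = d_i`, i.e. all the coefficients
`θ_i(x_j)` are homogeneous polynomials of degree `d_i` (or zero). -/
def IsFreeWithExp (A : HypArrangement K ℓ) (d : Fin ℓ → ℕ) : Prop :=
  ∃ θ : Module.Basis (Fin ℓ) (MvPolynomial (Fin ℓ) K) A.logDer,
    ∀ i j, ((θ i : Fin ℓ → MvPolynomial (Fin ℓ) K) j).IsHomogeneous (d i)

end HypArrangement

/-!
Write `n` for the number of planes of an arrangement and `b₂` for the sum of `m - 1` over its flats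
of rank two, `m` being the number of planes through the flat. The reduced characteristic polynomial
is `t² - (n - 1) t + (b₂ - n + 1)`, and deleting `H` lowers `n` by one and `b₂` by the number `h` of
lines that the other planes cut out on `H`. The bounds on the roots `c ≤ d` thus amount to the sign
of `(t - c) (t - d)` at `t = b`, respectively `t = b + 1`, once the following is known for a free
arrangement with exponents `(1, a, b)`, `a ≤ b`:

* `1 + a + b = n` and `a + b + a b ≤ b₂` (`exponents_of_isFree`);
* `h ≤ b + 1` for a member `H` (`card_traces_delete_le_of_isFree`);
* `a < h` for a plane `H` outside the arrangement (`lt_card_traces_of_isFree`).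

The full factorization theorem of Terao is not needed, only the inequality for `b₂`.

The main tool is Terao's polynomial (`teraoPoly_dvd`). If `H = ker α` is not in `A'` and `θ` is in
`D(A')`, the restriction of `θ(α)` to `H` vanishes to order `m - 1` along every line that lies in
exactly `m` members of `A'`, so it is divisible by a binary form `B` of degree `n' - h`, with `n'`
the number of planes of `A'`. Indeed, if `α` and `β` are coordinates vanishing on the line, the
determinant `α θ(β) - β θ(α)` is divisible by the `m` forms of the planes through it; restrict to
`α = 0` and cancel one factor `β`.

This gives `a < h`: if `h ≤ a`, then `B` has a larger degree than all members of the basis, so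
every member of `D(A')` would preserve the ideal of `H`. It also bounds the Hilbert function of
`D(A)`. For `A = A' ∪ {H}`, the module `D(A)` is the kernel of `θ ↦ θ(α)|_H` on `D(A')`, and the
image lies between the multiples of the defining polynomial of `A'`, restricted to `H`, and
the multiples of `B`. By induction, `dim D(A)_k` lies between two explicit quadratic polynomials
in `k` (`finrank_gradedLogDer_bounds`). Comparison with the Hilbert function of a free module with the given exponents yields
their sum and the inequality for `b₂`.

For a member `H`, the determinant of `θ|_H` and the Euler derivation of `H` is divisible by the `h`
forms of the lines on `H`. If `h > b + 1` it has to vanish on the basis for reasons of degree, hence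
on `D(A)`, which is refuted by a multiple of a constant derivation along `H`.
-/

namespace HypArrangement

variable {K : Type*} [Field K] {ℓ : ℕ}

/-! ### Linear forms as polynomials -/

theorem linPoly_isHomogeneous (α : Module.Dual K (Fin ℓ → K)) : (linPoly α).IsHomogeneous 1 :=
  MvPolynomial.IsHomogeneous.sum _ _ _ fun i _ => MvPolynomial.isHomogeneous_C_mul_X _ i

theorem coeff_linPoly (α : Module.Dual K (Fin ℓ → K)) (i : Fin ℓ) :
    (linPoly α).coeff (Finsupp.single i 1) = α (Pi.single i 1) := by
  classical
  simp [linPoly, MvPolynomial.coeff_sum, MvPolynomial.coeff_C_mul, MvPolynomial.coeff_X,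
    Finsupp.single_left_inj]

theorem linPoly_add (α β : Module.Dual K (Fin ℓ → K)) :
    linPoly (α + β) = linPoly α + linPoly β := by
  simp [linPoly, add_mul, Finset.sum_add_distrib]

theorem linPoly_smul (c : K) (α : Module.Dual K (Fin ℓ → K)) :
    linPoly (c • α) = MvPolynomial.C c * linPoly α := by
  simp [linPoly, Finset.mul_sum, mul_assoc]

theorem linPoly_zero : linPoly (0 : Module.Dual K (Fin ℓ → K)) = 0 := by
  simp [linPoly]

theorem linPoly_injective :
    Function.Injective (linPoly : Module.Dual K (Fin ℓ → K) → MvPolynomial (Fin ℓ) K) := by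
  intro α β h
  refine LinearMap.pi_ext' fun i => LinearMap.ext_ring ?_
  simpa [coeff_linPoly] using congrArg (fun p => p.coeff (Finsupp.single i 1)) h

theorem linPoly_ne_zero {α : Module.Dual K (Fin ℓ → K)} (h : α ≠ 0) : linPoly α ≠ 0 :=
  fun h0 => h (linPoly_injective (h0.trans linPoly_zero.symm))

theorem linPoly_prime {α : Module.Dual K (Fin ℓ → K)} (h : α ≠ 0) : Prime (linPoly α) := by
  have h1 := (linPoly_isHomogeneous α).totalDegree (linPoly_ne_zero h)
  refine (MvPolynomial.irreducible_of_totalDegree_eq_one h1 fun x hx => ?_).prime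
  have hx0 : x ≠ 0 := by
    rintro rfl
    refine linPoly_ne_zero h (MvPolynomial.ext _ _ fun i => ?_)
    simpa using hx i
  exact hx0.isUnit

theorem eq_smul_of_linPoly_dvd {α β : Module.Dual K (Fin ℓ → K)} (h : linPoly α ∣ linPoly β) :
    ∃ c : K, β = c • α := by
  by_cases hβ : β = 0
  · exact ⟨0, by simp [hβ]⟩
  obtain ⟨q, hq⟩ := h
  have hb := linPoly_ne_zero hβ
  have hα0 : linPoly α ≠ 0 := fun h0 => hb (by rw [hq, h0, zero_mul])
  have hq0 : q ≠ 0 := fun h0 => hb (by rw [hq, h0, mul_zero])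
  have h1 := MvPolynomial.totalDegree_mul_of_isDomain hα0 hq0
  rw [← hq, (linPoly_isHomogeneous β).totalDegree hb,
    (linPoly_isHomogeneous α).totalDegree hα0] at h1
  have h2 := (MvPolynomial.totalDegree_eq_zero_iff_eq_C (p := q)).mp (by omega)
  refine ⟨q.coeff 0, linPoly_injective ?_⟩
  rw [linPoly_smul, hq, mul_comm, ← h2]

theorem ker_eq_of_linPoly_dvd {α β : Module.Dual K (Fin ℓ → K)} (hβ : β ≠ 0)
    (h : linPoly α ∣ linPoly β) : LinearMap.ker α = LinearMap.ker β := by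
  obtain ⟨c, rfl⟩ := eq_smul_of_linPoly_dvd h
  have hc : c ≠ 0 := by rintro rfl; simp at hβ
  exact (LinearMap.ker_smul α c hc).symm

/-- Linear forms with different kernels have no common factor. -/
theorem linPoly_isRelPrime {α β : Module.Dual K (Fin ℓ → K)} (hα : α ≠ 0) (hβ : β ≠ 0)
    (h : LinearMap.ker α ≠ LinearMap.ker β) : IsRelPrime (linPoly α) (linPoly β) :=
  ((linPoly_prime hα).irreducible.isRelPrime_iff_not_dvd).mpr
    fun hd => h (ker_eq_of_linPoly_dvd hβ hd)

theorem dual_apply_eq_sum (α : Module.Dual K (Fin ℓ → K)) (w : Fin ℓ → K) :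
    α w = ∑ i, w i * α (Pi.single i 1) := by
  rw [LinearMap.pi_apply_eq_sum_univ α w]
  refine Finset.sum_congr rfl fun i _ => ?_
  have : (fun j => if i = j then (1 : K) else 0) = Pi.single i 1 := by
    funext j
    simp [Pi.single_apply, eq_comm]
  rw [this, smul_eq_mul]

/-! ### Restriction of polynomials along linear maps -/

/-- The algebra homomorphism `f ↦ f ∘ e` of polynomial functions induced by a linear map `e`. -/
noncomputable def pullback {m n : ℕ} (e : (Fin m → K) →ₗ[K] (Fin n → K)) :
    MvPolynomial (Fin n) K →ₐ[K] MvPolynomial (Fin m) K :=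
  MvPolynomial.aeval fun i => linPoly (LinearMap.proj i ∘ₗ e)

theorem pullback_linPoly {m n : ℕ} (e : (Fin m → K) →ₗ[K] (Fin n → K))
    (α : Module.Dual K (Fin n → K)) : pullback e (linPoly α) = linPoly (α ∘ₗ e) := by
  simp only [pullback, linPoly, map_sum, map_mul, MvPolynomial.aeval_X, MvPolynomial.algHom_C,
    MvPolynomial.algebraMap_eq, LinearMap.comp_apply, LinearMap.proj_apply]
  simp only [dual_apply_eq_sum α (e _), map_sum, map_mul, Finset.mul_sum, Finset.sum_mul]
  rw [Finset.sum_comm]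
  exact Finset.sum_congr rfl fun j _ => Finset.sum_congr rfl fun i _ => by ring

theorem linPoly_proj (i : Fin ℓ) :
    linPoly (LinearMap.proj i : Module.Dual K (Fin ℓ → K)) = MvPolynomial.X i := by
  simp [linPoly, Pi.single_apply]

theorem pullback_comp {m n k : ℕ} (e : (Fin m → K) →ₗ[K] (Fin n → K))
    (f : (Fin k → K) →ₗ[K] (Fin m → K)) :
    (pullback f).comp (pullback e) = pullback (e ∘ₗ f) := by
  refine MvPolynomial.algHom_ext fun i => ?_
  rw [AlgHom.comp_apply, ← linPoly_proj, pullback_linPoly, pullback_linPoly, pullback_linPoly,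
    LinearMap.comp_assoc]

theorem pullback_id : pullback (LinearMap.id : (Fin ℓ → K) →ₗ[K] (Fin ℓ → K)) = AlgHom.id K _ := by
  refine MvPolynomial.algHom_ext fun i => ?_
  rw [← linPoly_proj, pullback_linPoly, LinearMap.comp_id, AlgHom.id_apply]

theorem pullback_isHomogeneous {m n : ℕ} (e : (Fin m → K) →ₗ[K] (Fin n → K))
    {f : MvPolynomial (Fin n) K} {k : ℕ} (hf : f.IsHomogeneous k) :
    (pullback e f).IsHomogeneous k := by
  have := hf.aeval (n := 1) (fun i => linPoly (LinearMap.proj i ∘ₗ e))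
    fun i => linPoly_isHomogeneous _
  simpa [pullback] using this

/-- Coordinates adapted to the plane `ker α` of `K³`: a parametrization `e` of the plane, a
projection `π` onto the parameter space, and a vector `v` with `α v = 1` spanning the kernel
of `π`. -/
structure PlaneFrame (α : Module.Dual K (Fin 3 → K)) where
  /-- the parametrization of the plane -/
  e : (Fin 2 → K) →ₗ[K] (Fin 3 → K)
  /-- the projection onto the parameter space -/
  π : (Fin 3 → K) →ₗ[K] (Fin 2 → K)
  /-- the transversal vector -/
  v : Fin 3 → K
  apply_v : α v = 1
  comp_e : α ∘ₗ e = 0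
  π_e : π ∘ₗ e = LinearMap.id
  decomp : ∀ x, x = e (π x) + α x • v

theorem exists_planeFrame {α : Module.Dual K (Fin 3 → K)} (hα : α ≠ 0) :
    Nonempty (PlaneFrame α) := by
  obtain ⟨w, hw⟩ : ∃ w, α w ≠ 0 := by
    by_contra! h
    exact hα (LinearMap.ext h)
  obtain ⟨v, hv⟩ : ∃ v, α v = 1 := ⟨(α w)⁻¹ • w, by simp [hw]⟩
  have hdim : Module.finrank K (LinearMap.ker α) = Module.finrank K (Fin 2 → K) := by
    have h1 := LinearMap.finrank_range_add_finrank_ker α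
    have h2 : LinearMap.range α = ⊤ := LinearMap.range_eq_top.mpr fun c => ⟨c • v, by simp [hv]⟩
    rw [h2, finrank_top, Module.finrank_self, Module.finrank_fin_fun] at h1
    rw [Module.finrank_fin_fun]
    omega
  let φ := LinearEquiv.ofFinrankEq _ _ hdim
  let p : (Fin 3 → K) →ₗ[K] LinearMap.ker α :=
    (LinearMap.id - α.smulRight v).codRestrict _ fun x => by simp [hv]
  have hpc : ∀ x, (p x : Fin 3 → K) = x - α x • v := fun x => rfl
  refine ⟨⟨(LinearMap.ker α).subtype ∘ₗ φ.symm.toLinearMap, φ.toLinearMap ∘ₗ p, v, hv, ?_, ?_, ?_⟩⟩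
  · ext1 i
    ext1
    simp
  · have hp : ∀ y : LinearMap.ker α, p y = y := fun y => Subtype.ext (by
      have : α y = 0 := y.2
      rw [hpc, this, zero_smul, sub_zero])
    refine LinearMap.ext fun x => ?_
    simp [hp]
  · intro x
    simp [hpc]

namespace PlaneFrame

variable {α : Module.Dual K (Fin 3 → K)} (F : PlaneFrame α)

/-- Restriction of polynomials on `K³` to the plane of the frame, as polynomials in the two
parameters. -/
noncomputable def res : MvPolynomial (Fin 3) K →ₐ[K] MvPolynomial (Fin 2) K := pullback F.e

theorem res_linPoly (β : Module.Dual K (Fin 3 → K)) : F.res (linPoly β) = linPoly (β ∘ₗ F.e) :=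
  pullback_linPoly _ _

theorem res_self : F.res (linPoly α) = 0 := by
  rw [res_linPoly, F.comp_e, linPoly_zero]

theorem res_pullback (g : MvPolynomial (Fin 2) K) : F.res (pullback F.π g) = g := by
  have h := DFunLike.congr_fun (pullback_comp F.π F.e) g
  rwa [F.π_e, pullback_id] at h

theorem res_isHomogeneous {f : MvPolynomial (Fin 3) K} {k : ℕ} (hf : f.IsHomogeneous k) :
    (F.res f).IsHomogeneous k :=
  pullback_isHomogeneous _ hf

/-- A linear form is, up to a multiple of `α`, the pullback of its restriction. -/
theorem form_decomp (β : Module.Dual K (Fin 3 → K)) :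
    β = (β ∘ₗ F.e) ∘ₗ F.π + β F.v • α := by
  refine LinearMap.ext fun x => ?_
  conv_lhs => rw [F.decomp x]
  simp [mul_comm]

/-- A polynomial vanishes on the plane if and only if its linear form divides it. -/
theorem res_eq_zero_iff (f : MvPolynomial (Fin 3) K) : F.res f = 0 ↔ linPoly α ∣ f := by
  constructor
  · intro h
    -- modulo `α`, every polynomial is the pullback of its restriction
    have h1 : (Ideal.Quotient.mkₐ K (Ideal.span {linPoly α})).comp
        ((pullback F.π).comp (pullback F.e)) = Ideal.Quotient.mkₐ K _ := by
      refine MvPolynomial.algHom_ext fun i => ?_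
      rw [AlgHom.comp_apply, AlgHom.comp_apply, ← linPoly_proj, pullback_linPoly,
        pullback_linPoly]
      conv_rhs => rw [F.form_decomp (LinearMap.proj i), linPoly_add, linPoly_smul, map_add, map_mul]
      have : Ideal.Quotient.mkₐ K (Ideal.span {linPoly α}) (linPoly α) = 0 :=
        Ideal.Quotient.eq_zero_iff_mem.mpr (Ideal.mem_span_singleton_self _)
      rw [this, mul_zero, add_zero]
    have h2 := DFunLike.congr_fun h1 f
    have h3 : pullback F.e f = 0 := h
    rw [AlgHom.comp_apply, AlgHom.comp_apply, h3, map_zero, map_zero] at h2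
    exact Ideal.mem_span_singleton.mp (Ideal.Quotient.eq_zero_iff_mem.mp h2.symm)
  · rintro ⟨g, rfl⟩
    rw [map_mul, F.res_self, zero_mul]

theorem ker_comp_e (β : Module.Dual K (Fin 3 → K)) :
    (LinearMap.ker (β ∘ₗ F.e)).map F.e = LinearMap.ker β ⊓ LinearMap.ker α := by
  ext x
  constructor
  · rintro ⟨y, hy, rfl⟩
    exact ⟨hy, DFunLike.congr_fun F.comp_e y⟩
  · rintro ⟨h1, h2⟩
    have hx : x = F.e (F.π x) := by
      have h := F.decomp x
      rwa [LinearMap.mem_ker.mp h2, zero_smul, add_zero] at h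
    refine ⟨F.π x, ?_, hx.symm⟩
    rw [SetLike.mem_coe, LinearMap.mem_ker, LinearMap.comp_apply, ← hx]
    exact h1

theorem comp_e_ne_zero {β : Module.Dual K (Fin 3 → K)} (hβ : β ≠ 0)
    (h : LinearMap.ker β ≠ LinearMap.ker α) : β ∘ₗ F.e ≠ 0 := by
  intro h0
  have h1 := F.form_decomp β
  rw [h0, LinearMap.zero_comp, zero_add] at h1
  have hc : β F.v ≠ 0 := fun hc => hβ (by rw [h1, hc, zero_smul])
  exact h (by rw [h1, LinearMap.ker_smul _ _ hc])

end PlaneFrame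

/-! ### Graded pieces of polynomial rings -/

theorem homogeneousComponent_mul_right {σ : Type*} (f g : MvPolynomial σ K) {d k : ℕ}
    (hg : g.IsHomogeneous d) (hdk : d ≤ k) :
    MvPolynomial.homogeneousComponent k (f * g)
      = MvPolynomial.homogeneousComponent (k - d) f * g := by
  have h : ∀ i, MvPolynomial.homogeneousComponent k (MvPolynomial.homogeneousComponent i f * g)
      = if i = k - d then MvPolynomial.homogeneousComponent i f * g else 0 := fun i => by
    rw [MvPolynomial.homogeneousComponent_of_mem
      ((MvPolynomial.homogeneousComponent_isHomogeneous i f).mul hg)]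
    exact if_congr (by omega) rfl rfl
  conv_lhs => rw [← MvPolynomial.sum_homogeneousComponent f, Finset.sum_mul, map_sum]
  simp only [h, Finset.sum_ite_eq', Finset.mem_range]
  split_ifs with h1
  · rfl
  · rw [MvPolynomial.homogeneousComponent_eq_zero (k - d) f (by omega), zero_mul]

instance finiteDimensional_homogeneousSubmodule (n k : ℕ) :
    FiniteDimensional K (MvPolynomial.homogeneousSubmodule (Fin n) K k) :=
  Module.Finite.iff_fg.mpr (MvPolynomial.homogeneousSubmodule_fg _ _ k)

theorem finrank_homogeneousSubmodule (n k : ℕ) :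
    Module.finrank K (MvPolynomial.homogeneousSubmodule (Fin n) K k) = n.multichoose k := by
  classical
  have hs : {d : Fin n →₀ ℕ | d.degree = k}
      = ((Finset.univ : Finset (Fin n)).finsuppAntidiag k : Set (Fin n →₀ ℕ)) := by
    ext d
    simp [Finset.mem_finsuppAntidiag, Finsupp.degree_eq_sum]
  rw [MvPolynomial.homogeneousSubmodule_eq_finsupp_supported, hs,
    (AddMonoidAlgebra.supportedEquivFinsupp _).finrank_eq, Module.finrank_finsupp_self]
  simp only [Finset.coe_sort_coe, Fintype.card_coe]
  rw [Finset.card_finsuppAntidiag_nat_eq_multichoose]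
  simp

theorem finrank_homogeneousSubmodule_two (k : ℕ) :
    Module.finrank K (MvPolynomial.homogeneousSubmodule (Fin 2) K k) = k + 1 := by
  rw [finrank_homogeneousSubmodule, Nat.multichoose_two]

theorem two_mul_finrank_homogeneousSubmodule_three (k : ℕ) :
    2 * Module.finrank K (MvPolynomial.homogeneousSubmodule (Fin 3) K k) = (k + 1) * (k + 2) := by
  rw [finrank_homogeneousSubmodule, Nat.multichoose_eq]
  have h : 3 + k - 1 = k + 2 := by omega
  rw [h, ← Nat.choose_symm_of_eq_add (n := k + 2) (a := 2) (b := k) (by omega),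
    Nat.choose_two_right, Nat.mul_div_cancel' (Nat.even_mul_pred_self _).two_dvd]
  simp [mul_comm]

/-- The products of the polynomial `g` with the forms of degree `j`. -/
noncomputable def formMultiples {n : ℕ} (g : MvPolynomial (Fin n) K) (j : ℕ) :
    Submodule K (MvPolynomial (Fin n) K) :=
  (MvPolynomial.homogeneousSubmodule (Fin n) K j).map (LinearMap.mulLeft K g)

instance finiteDimensional_formMultiples {n : ℕ} (g : MvPolynomial (Fin n) K) (j : ℕ) :
    FiniteDimensional K (formMultiples g j) := by
  unfold formMultiples
  infer_instance

theorem finrank_formMultiples {n : ℕ} {g : MvPolynomial (Fin n) K} (hg : g ≠ 0) (j : ℕ) :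
    Module.finrank K (formMultiples g j)
      = Module.finrank K (MvPolynomial.homogeneousSubmodule (Fin n) K j) :=
  (Submodule.equivMapOfInjective _ (fun _ _ h => mul_left_cancel₀ hg h) _).finrank_eq.symm

theorem mem_formMultiples {n d k : ℕ} {f g : MvPolynomial (Fin n) K} (hg : g.IsHomogeneous d)
    (hf : f.IsHomogeneous k) (hd : d ≤ k) (h : g ∣ f) : f ∈ formMultiples g (k - d) := by
  obtain ⟨q, rfl⟩ := h
  refine ⟨MvPolynomial.homogeneousComponent (k - d) q,
    MvPolynomial.homogeneousComponent_isHomogeneous _ _, ?_⟩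
  have h1 := homogeneousComponent_mul_right q g hg hd
  rw [mul_comm q g, MvPolynomial.homogeneousComponent_eq_self hf] at h1
  rw [LinearMap.mulLeft_apply, mul_comm, ← h1]

theorem eq_zero_of_dvd_of_degree_lt {n d k : ℕ} {f g : MvPolynomial (Fin n) K}
    (hg : g.IsHomogeneous d) (hf : f.IsHomogeneous k) (hd : k < d) (h : g ∣ f) : f = 0 := by
  by_contra hf0
  have hg0 : g ≠ 0 := fun h0 => hf0 (zero_dvd_iff.mp (h0 ▸ h))
  obtain ⟨q, rfl⟩ := h
  have h1 := MvPolynomial.totalDegree_mul_of_isDomain hg0 (right_ne_zero_of_mul hf0)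
  rw [hf.totalDegree hf0, hg.totalDegree hg0] at h1
  omega

/-! ### Derivations applied to linear forms -/

/-- The value `θ(α)` of a derivation `θ` at a linear form `α`, as a linear function of `θ`. -/
noncomputable def derForm (α : Module.Dual K (Fin ℓ → K)) :
    (Fin ℓ → MvPolynomial (Fin ℓ) K) →ₗ[MvPolynomial (Fin ℓ) K] MvPolynomial (Fin ℓ) K :=
  ∑ i : Fin ℓ, (MvPolynomial.C (α (Pi.single i 1)) : MvPolynomial (Fin ℓ) K) •
    (LinearMap.proj i : (Fin ℓ → MvPolynomial (Fin ℓ) K) →ₗ[MvPolynomial (Fin ℓ) K] _)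

theorem derForm_apply (α : Module.Dual K (Fin ℓ → K)) (θ : Fin ℓ → MvPolynomial (Fin ℓ) K) :
    derForm α θ = ∑ i, MvPolynomial.C (α (Pi.single i 1)) * θ i := by
  simp [derForm]

theorem applyDer_linPoly (α : Module.Dual K (Fin ℓ → K)) (θ : Fin ℓ → MvPolynomial (Fin ℓ) K) :
    applyDer θ (linPoly α) = derForm α θ := by
  rw [derForm_apply, applyDer]
  refine Finset.sum_congr rfl fun i _ => ?_
  simp [linPoly, MvPolynomial.pderiv_X, Pi.single_apply, mul_comm]

theorem derForm_add (α β : Module.Dual K (Fin ℓ → K)) (θ : Fin ℓ → MvPolynomial (Fin ℓ) K) :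
    derForm (α + β) θ = derForm α θ + derForm β θ := by
  simp [derForm_apply, add_mul, Finset.sum_add_distrib]

theorem derForm_smul (c : K) (α : Module.Dual K (Fin ℓ → K))
    (θ : Fin ℓ → MvPolynomial (Fin ℓ) K) :
    derForm (c • α) θ = MvPolynomial.C c * derForm α θ := by
  simp [derForm_apply, Finset.mul_sum, mul_assoc]

theorem derForm_isHomogeneous (α : Module.Dual K (Fin ℓ → K))
    {θ : Fin ℓ → MvPolynomial (Fin ℓ) K} {k : ℕ} (h : ∀ i, (θ i).IsHomogeneous k) :
    (derForm α θ).IsHomogeneous k := by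
  rw [derForm_apply]
  exact MvPolynomial.IsHomogeneous.sum _ _ _ fun i _ => (h i).C_mul _

/-- The derivation with constant coefficients in the direction of the vector `w`. -/
noncomputable def constDer (w : Fin ℓ → K) : Fin ℓ → MvPolynomial (Fin ℓ) K :=
  fun i => MvPolynomial.C (w i)

theorem derForm_constDer (α : Module.Dual K (Fin ℓ → K)) (w : Fin ℓ → K) :
    derForm α (constDer w) = MvPolynomial.C (α w) := by
  rw [derForm_apply, dual_apply_eq_sum α w, map_sum]
  exact Finset.sum_congr rfl fun i _ => by rw [constDer, map_mul, mul_comm]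

theorem exists_eq_smul_of_ker_le {α β : Module.Dual K (Fin ℓ → K)}
    (h : LinearMap.ker α ≤ LinearMap.ker β) : ∃ c : K, β = c • α := by
  have h1 := mem_span_of_iInf_ker_le_ker (L := fun _ : Unit => α) (K := β) (by simpa using h)
  rw [Set.range_const, Submodule.mem_span_singleton] at h1
  obtain ⟨c, hc⟩ := h1
  exact ⟨c, hc.symm⟩

theorem linPoly_dvd_derForm_of_ker_eq {α β : Module.Dual K (Fin ℓ → K)}
    (h : LinearMap.ker α = LinearMap.ker β) {θ : Fin ℓ → MvPolynomial (Fin ℓ) K}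
    (hα : linPoly α ∣ derForm α θ) : linPoly β ∣ derForm β θ := by
  obtain ⟨c, rfl⟩ := exists_eq_smul_of_ker_le h.le
  rw [linPoly_smul, derForm_smul]
  exact mul_dvd_mul_left _ hα

/-! ### Defining forms of hyperplanes -/

open Classical in
/-- A nonzero linear form with kernel `H`, if `H` is a hyperplane; the value is `0` otherwise. -/
noncomputable def planeForm (H : Submodule K (Fin ℓ → K)) : Module.Dual K (Fin ℓ → K) :=
  if h : ∃ α : Module.Dual K (Fin ℓ → K), α ≠ 0 ∧ LinearMap.ker α = H then h.choose else 0

theorem planeForm_ker_spec {α : Module.Dual K (Fin ℓ → K)} (hα : α ≠ 0) :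
    planeForm (LinearMap.ker α) ≠ 0 ∧ LinearMap.ker (planeForm (LinearMap.ker α))
      = LinearMap.ker α := by
  have h : ∃ β : Module.Dual K (Fin ℓ → K), β ≠ 0 ∧ LinearMap.ker β = LinearMap.ker α :=
    ⟨α, hα, rfl⟩
  rw [planeForm, dif_pos h]
  exact h.choose_spec

theorem exists_form (A : HypArrangement K ℓ) {H : Submodule K (Fin ℓ → K)} (hH : H ∈ A.planes) :
    ∃ α : Module.Dual K (Fin ℓ → K), α ≠ 0 ∧ LinearMap.ker α = H := by
  have h := A.codim_one H hH
  have hlt : H < ⊤ := by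
    refine lt_top_iff_ne_top.mpr fun h0 => ?_
    rw [h0, finrank_top, Module.finrank_fin_fun] at h
    omega
  obtain ⟨α, hα, hle⟩ := Submodule.exists_le_ker_of_lt_top H hlt
  refine ⟨α, hα, (Submodule.eq_of_le_of_finrank_le hle ?_).symm⟩
  have h1 : LinearMap.ker α < ⊤ := lt_top_iff_ne_top.mpr fun h0 => hα (LinearMap.ker_eq_top.mp h0)
  have h2 := Submodule.finrank_lt_finrank_of_lt h1
  rw [finrank_top, Module.finrank_fin_fun] at h2
  omega

theorem planeForm_ne_zero (A : HypArrangement K ℓ) {H : Submodule K (Fin ℓ → K)}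
    (hH : H ∈ A.planes) : planeForm H ≠ 0 := by
  obtain ⟨α, hα, rfl⟩ := A.exists_form hH
  exact (planeForm_ker_spec hα).1

theorem ker_planeForm (A : HypArrangement K ℓ) {H : Submodule K (Fin ℓ → K)}
    (hH : H ∈ A.planes) : LinearMap.ker (planeForm H) = H := by
  obtain ⟨α, hα, rfl⟩ := A.exists_form hH
  exact (planeForm_ker_spec hα).2

theorem mem_logDer_iff (A : HypArrangement K ℓ) (θ : Fin ℓ → MvPolynomial (Fin ℓ) K) :
    θ ∈ A.logDer ↔ ∀ H ∈ A.planes, linPoly (planeForm H) ∣ derForm (planeForm H) θ := by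
  constructor
  · intro h H hH
    rw [← applyDer_linPoly]
    exact h H hH _ (A.ker_planeForm hH)
  · intro h H hH α hα
    rw [applyDer_linPoly]
    exact linPoly_dvd_derForm_of_ker_eq ((A.ker_planeForm hH).trans hα.symm) (h H hH)

theorem mem_logDer_iff_delete (A : HypArrangement K ℓ) {α : Module.Dual K (Fin ℓ → K)}
    (hα : LinearMap.ker α ∈ A.planes) (θ : Fin ℓ → MvPolynomial (Fin ℓ) K) :
    θ ∈ A.logDer ↔ θ ∈ (A.delete (LinearMap.ker α)).logDer ∧ linPoly α ∣ derForm α θ := by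
  classical
  rw [mem_logDer_iff, mem_logDer_iff]
  constructor
  · intro h
    exact ⟨fun H hH => h H (Finset.mem_of_mem_erase hH),
      linPoly_dvd_derForm_of_ker_eq (A.ker_planeForm hα) (h _ hα)⟩
  · rintro ⟨h1, h2⟩ H hH
    by_cases hHα : H = LinearMap.ker α
    · rw [hHα]
      exact linPoly_dvd_derForm_of_ker_eq (A.ker_planeForm hα).symm h2
    · exact h1 H (Finset.mem_erase.mpr ⟨hHα, hH⟩)

/-- The defining polynomial of an arrangement. -/
noncomputable def defPoly (A : HypArrangement K ℓ) : MvPolynomial (Fin ℓ) K :=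
  ∏ H ∈ A.planes, linPoly (planeForm H)

theorem defPoly_isHomogeneous (A : HypArrangement K ℓ) :
    A.defPoly.IsHomogeneous A.planes.card := by
  have h := MvPolynomial.IsHomogeneous.prod A.planes (fun H => linPoly (planeForm H))
    (fun _ => 1) fun H _ => linPoly_isHomogeneous _
  simpa [defPoly] using h

theorem defPoly_smul_mem_logDer (A : HypArrangement K ℓ)
    (θ : Fin ℓ → MvPolynomial (Fin ℓ) K) : A.defPoly • θ ∈ A.logDer := by
  rw [mem_logDer_iff]
  intro H hH
  rw [map_smul, smul_eq_mul]
  exact Dvd.dvd.mul_right (Finset.dvd_prod_of_mem _ hH) _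

theorem res_defPoly_ne_zero (A : HypArrangement K 3) {α : Module.Dual K (Fin 3 → K)}
    (hα : LinearMap.ker α ∉ A.planes) (F : PlaneFrame α) : F.res A.defPoly ≠ 0 := by
  rw [defPoly, map_prod, Finset.prod_ne_zero_iff]
  intro H hH
  rw [F.res_linPoly]
  refine linPoly_ne_zero (F.comp_e_ne_zero (A.planeForm_ne_zero hH) ?_)
  rw [A.ker_planeForm hH]
  rintro rfl
  exact hα hH

/-! ### The trace of an arrangement on a plane -/

open Classical in
/-- The lines cut out on the plane of the frame by the members of `A`, as lines in the
two-dimensional parameter space. -/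
noncomputable def traces (A : HypArrangement K 3) {α : Module.Dual K (Fin 3 → K)}
    (F : PlaneFrame α) : Finset (Submodule K (Fin 2 → K)) :=
  A.planes.image fun H => H.comap F.e

open Classical in
/-- The members of `A` that cut out the line `Y` on the plane of the frame. -/
noncomputable def planesOver (A : HypArrangement K 3) {α : Module.Dual K (Fin 3 → K)}
    (F : PlaneFrame α) (Y : Submodule K (Fin 2 → K)) : Finset (Submodule K (Fin 3 → K)) :=
  A.planes.filter fun H => H.comap F.e = Y

theorem mem_planesOver {A : HypArrangement K 3} {α : Module.Dual K (Fin 3 → K)}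
    {F : PlaneFrame α} {Y : Submodule K (Fin 2 → K)} {H : Submodule K (Fin 3 → K)} :
    H ∈ A.planesOver F Y ↔ H ∈ A.planes ∧ H.comap F.e = Y := by
  classical
  exact Finset.mem_filter

theorem exists_of_mem_traces {A : HypArrangement K 3} {α : Module.Dual K (Fin 3 → K)}
    {F : PlaneFrame α} {Y : Submodule K (Fin 2 → K)} (hY : Y ∈ A.traces F) :
    ∃ H ∈ A.planes, H.comap F.e = Y := by
  classical
  exact Finset.mem_image.mp hY

open Classical in
theorem card_traces (A : HypArrangement K 3) {α : Module.Dual K (Fin 3 → K)} (F : PlaneFrame α) :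
    (A.traces F).card = (A.planes.image fun H => H ⊓ LinearMap.ker α).card := by
  have hr : LinearMap.range F.e = LinearMap.ker α := by
    simpa using F.ker_comp_e 0
  have hinj : Function.Injective F.e := fun x y h => by
    have h1 := congrArg F.π h
    have h2 := fun z => DFunLike.congr_fun F.π_e z
    simp only [LinearMap.comp_apply, LinearMap.id_apply] at h2
    rwa [h2, h2] at h1
  have h : (A.planes.image fun H => H ⊓ LinearMap.ker α)
      = (A.traces F).image (Submodule.map F.e) := by
    rw [traces, Finset.image_image]
    refine Finset.image_congr fun H _ => ?_
    rw [Function.comp_apply, Submodule.map_comap_eq, hr, inf_comm]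
  rw [h, Finset.card_image_of_injective _ (Submodule.map_injective_of_injective hinj)]

theorem sum_card_planesOver (A : HypArrangement K 3) {α : Module.Dual K (Fin 3 → K)}
    (F : PlaneFrame α) :
    ∑ Y ∈ A.traces F, ((A.planesOver F Y).card - 1) + (A.traces F).card = A.planes.card := by
  classical
  have h1 : A.planes.card = ∑ Y ∈ A.traces F, (A.planesOver F Y).card :=
    Finset.card_eq_sum_card_image _ _
  rw [h1, Finset.card_eq_sum_ones, ← Finset.sum_add_distrib]
  refine Finset.sum_congr rfl fun Y hY => Nat.sub_add_cancel ?_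
  obtain ⟨H, hH, hHY⟩ := exists_of_mem_traces hY
  exact Finset.card_pos.mpr ⟨H, mem_planesOver.mpr ⟨hH, hHY⟩⟩

theorem comp_e_planeForm_ne_zero (A : HypArrangement K 3) {α : Module.Dual K (Fin 3 → K)}
    (hα : LinearMap.ker α ∉ A.planes) (F : PlaneFrame α) {H : Submodule K (Fin 3 → K)}
    (hH : H ∈ A.planes) : planeForm H ∘ₗ F.e ≠ 0 := by
  refine F.comp_e_ne_zero (A.planeForm_ne_zero hH) ?_
  rw [A.ker_planeForm hH]
  rintro rfl
  exact hα hH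

theorem ker_planeForm_comp_e (A : HypArrangement K 3) {α : Module.Dual K (Fin 3 → K)}
    (F : PlaneFrame α) {H : Submodule K (Fin 3 → K)} (hH : H ∈ A.planes) :
    LinearMap.ker (planeForm H ∘ₗ F.e) = H.comap F.e := by
  rw [LinearMap.ker_comp, A.ker_planeForm hH]

theorem planeForm_trace_spec (A : HypArrangement K 3) {α : Module.Dual K (Fin 3 → K)}
    (hα : LinearMap.ker α ∉ A.planes) (F : PlaneFrame α) {Y : Submodule K (Fin 2 → K)}
    (hY : Y ∈ A.traces F) : planeForm Y ≠ 0 ∧ LinearMap.ker (planeForm Y) = Y := by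
  obtain ⟨H, hH, rfl⟩ := exists_of_mem_traces hY
  rw [← A.ker_planeForm_comp_e F hH]
  exact planeForm_ker_spec (A.comp_e_planeForm_ne_zero hα F hH)

/-- The forms of distinct traces, or powers of them, have no common factor, so a polynomial
divisible by each of them is divisible by their product. -/
theorem prod_traces_dvd (A : HypArrangement K 3) {α : Module.Dual K (Fin 3 → K)}
    (hα : LinearMap.ker α ∉ A.planes) (F : PlaneFrame α) (m : Submodule K (Fin 2 → K) → ℕ)
    {f : MvPolynomial (Fin 2) K} (h : ∀ Y ∈ A.traces F, linPoly (planeForm Y) ^ m Y ∣ f) :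
    ∏ Y ∈ A.traces F, linPoly (planeForm Y) ^ m Y ∣ f := by
  refine Finset.prod_dvd_of_isRelPrime (fun Y hY Z hZ hYZ => ?_) h
  have hY' := A.planeForm_trace_spec hα F hY
  have hZ' := A.planeForm_trace_spec hα F hZ
  refine (linPoly_isRelPrime hY'.1 hZ'.1 ?_).pow
  rwa [hY'.2, hZ'.2]

/-- Along a line `Y` of the plane `ker α` that lies in exactly `m` members of `A`, the restriction
of `θ(α)` vanishes to order `m - 1`. -/
theorem pow_dvd_res_derForm (A : HypArrangement K 3) {α : Module.Dual K (Fin 3 → K)}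
    (hα : LinearMap.ker α ∉ A.planes) (F : PlaneFrame α) {θ : Fin 3 → MvPolynomial (Fin 3) K}
    (hθ : θ ∈ A.logDer) {Y : Submodule K (Fin 2 → K)} (hY : Y ∈ A.traces F) :
    linPoly (planeForm Y) ^ ((A.planesOver F Y).card - 1) ∣ F.res (derForm α θ) := by
  rw [mem_logDer_iff] at hθ
  obtain ⟨hY0, hYker⟩ := A.planeForm_trace_spec hα F hY
  -- the restriction of each form over `Y` is a nonzero multiple of the form of `Y`
  have hrep : ∀ H ∈ A.planesOver F Y, ∃ c : K, c ≠ 0 ∧ planeForm H ∘ₗ F.e = c • planeForm Y := by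
    intro H hH
    obtain ⟨hHA, hHY⟩ := mem_planesOver.mp hH
    obtain ⟨c, hc⟩ := exists_eq_smul_of_ker_le (α := planeForm Y) (β := planeForm H ∘ₗ F.e)
      (by rw [hYker, A.ker_planeForm_comp_e F hHA, hHY])
    refine ⟨c, ?_, hc⟩
    rintro rfl
    exact A.comp_e_planeForm_ne_zero hα F hHA (by rw [hc, zero_smul])
  obtain ⟨H₀, hH₀A, hH₀Y⟩ := exists_of_mem_traces hY
  have hH₀ : H₀ ∈ A.planesOver F Y := mem_planesOver.mpr ⟨hH₀A, hH₀Y⟩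
  obtain ⟨c₀, hc₀, hβ⟩ := hrep H₀ hH₀
  set β := planeForm H₀ with hβdef
  -- `W` is the determinant of `θ` and the Euler derivation in the coordinates `α`, `β`
  set W := linPoly α * derForm β θ - linPoly β * derForm α θ with hW
  have hdvd : ∀ H ∈ A.planesOver F Y, linPoly (planeForm H) ∣ W := by
    intro H hH
    obtain ⟨c, hc, hγ⟩ := hrep H hH
    have hγ' : planeForm H
        = (c * c₀⁻¹) • β + (planeForm H F.v - c * c₀⁻¹ * β F.v) • α := by
      conv_lhs => rw [F.form_decomp (planeForm H), hγ]
      conv_rhs => rw [F.form_decomp β, hβ]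
      refine LinearMap.ext fun x => ?_
      have h1 : α F.v = 1 := F.apply_v
      have h2 : F.π F.v = 0 := by
        have h3 := congrArg F.π (F.decomp F.v)
        have h4 := DFunLike.congr_fun F.π_e (F.π F.v)
        rw [LinearMap.comp_apply, LinearMap.id_apply] at h4
        rw [map_add, h4, h1, one_smul] at h3
        simpa using h3
      simp only [LinearMap.add_apply, LinearMap.smul_apply, LinearMap.comp_apply, smul_eq_mul, h2,
        map_zero, h1]
      field_simp
      ring
    set a := c * c₀⁻¹ with ha
    have ha0 : a ≠ 0 := mul_ne_zero hc (inv_ne_zero hc₀)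
    set b := planeForm H F.v - a * β F.v
    have key : MvPolynomial.C a * W
        = linPoly α * derForm (planeForm H) θ - linPoly (planeForm H) * derForm α θ := by
      rw [hγ', linPoly_add, linPoly_smul, linPoly_smul, derForm_add, derForm_smul, derForm_smul,
        hW]
      ring
    have h1 : linPoly (planeForm H) ∣ MvPolynomial.C a * W := by
      rw [key]
      exact dvd_sub (Dvd.dvd.mul_left (hθ H (mem_planesOver.mp hH).1) _) (Dvd.intro _ rfl)
    exact (IsUnit.dvd_mul_left ((Ne.isUnit ha0).map MvPolynomial.C)).mp h1
  have hprod : ∏ H ∈ A.planesOver F Y, linPoly (planeForm H) ∣ W := by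
    refine Finset.prod_dvd_of_isRelPrime (fun H hH H' hH' hne => ?_) hdvd
    have h1 := (mem_planesOver.mp hH).1
    have h2 := (mem_planesOver.mp hH').1
    refine linPoly_isRelPrime (A.planeForm_ne_zero h1) (A.planeForm_ne_zero h2) ?_
    rwa [A.ker_planeForm h1, A.ker_planeForm h2]
  have hpow : linPoly (planeForm Y) ^ (A.planesOver F Y).card ∣ F.res W := by
    refine dvd_trans ?_ (map_dvd F.res hprod)
    rw [map_prod, ← Finset.prod_const]
    refine Finset.prod_dvd_prod_of_dvd _ _ fun H hH => ?_
    obtain ⟨c, -, hγ⟩ := hrep H hH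
    rw [F.res_linPoly, hγ, linPoly_smul]
    exact Dvd.intro_left _ rfl
  have hresW : F.res W
      = linPoly (planeForm Y) * (MvPolynomial.C (-c₀) * F.res (derForm α θ)) := by
    rw [hW, map_sub, map_mul, map_mul, F.res_self, F.res_linPoly, hβ, linPoly_smul, map_neg]
    ring
  have hcard : (A.planesOver F Y).card = ((A.planesOver F Y).card - 1) + 1 :=
    (Nat.sub_add_cancel (Finset.card_pos.mpr ⟨H₀, hH₀⟩)).symm
  rw [hresW, hcard, pow_succ'] at hpow
  have h1 := (mul_dvd_mul_iff_left (linPoly_ne_zero hY0)).mp hpow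
  exact (IsUnit.dvd_mul_left ((Ne.isUnit (neg_ne_zero.mpr hc₀)).map MvPolynomial.C)).mp h1

/-- Terao's polynomial `B`: the product over the lines cut out by `A` on the plane of the frame,
each taken one time fewer than the number of members of `A` that contain it. -/
noncomputable def teraoPoly (A : HypArrangement K 3) {α : Module.Dual K (Fin 3 → K)}
    (F : PlaneFrame α) : MvPolynomial (Fin 2) K :=
  ∏ Y ∈ A.traces F, linPoly (planeForm Y) ^ ((A.planesOver F Y).card - 1)

theorem teraoPoly_isHomogeneous (A : HypArrangement K 3) {α : Module.Dual K (Fin 3 → K)}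
    (F : PlaneFrame α) :
    (A.teraoPoly F).IsHomogeneous (A.planes.card - (A.traces F).card) := by
  rw [← A.sum_card_planesOver F, Nat.add_sub_cancel]
  refine MvPolynomial.IsHomogeneous.prod _ _ _ fun Y _ => ?_
  simpa using (linPoly_isHomogeneous (planeForm Y)).pow ((A.planesOver F Y).card - 1)

theorem teraoPoly_ne_zero (A : HypArrangement K 3) {α : Module.Dual K (Fin 3 → K)}
    (hα : LinearMap.ker α ∉ A.planes) (F : PlaneFrame α) : A.teraoPoly F ≠ 0 :=
  Finset.prod_ne_zero_iff.mpr fun _ hY =>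
    pow_ne_zero _ (linPoly_ne_zero (A.planeForm_trace_spec hα F hY).1)

theorem teraoPoly_dvd (A : HypArrangement K 3) {α : Module.Dual K (Fin 3 → K)}
    (hα : LinearMap.ker α ∉ A.planes) (F : PlaneFrame α) {θ : Fin 3 → MvPolynomial (Fin 3) K}
    (hθ : θ ∈ A.logDer) : A.teraoPoly F ∣ F.res (derForm α θ) :=
  A.prod_traces_dvd hα F _ fun _ hY => A.pow_dvd_res_derForm hα F hθ hY

/-! ### Rank two flats and the characteristic polynomial -/

open Classical in
/-- The flats of rank two: the intersections of two distinct members of `A`. -/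
noncomputable def rankTwoFlats (A : HypArrangement K 3) : Finset (Submodule K (Fin 3 → K)) :=
  A.planes.offDiag.image fun p => p.1 ⊓ p.2

open Classical in
/-- The members of `A` that contain `X`. -/
noncomputable def planesAbove (A : HypArrangement K 3) (X : Submodule K (Fin 3 → K)) :
    Finset (Submodule K (Fin 3 → K)) :=
  A.planes.filter fun H => X ≤ H

/-- The sum of `m - 1` over the flats of rank two, where `m` is the number of members of `A`
containing the flat. This is the coefficient of `t` in the characteristic polynomial. -/
noncomputable def secondBetti (A : HypArrangement K 3) : ℕ :=
  ∑ X ∈ A.rankTwoFlats, ((A.planesAbove X).card - 1)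

theorem mem_rankTwoFlats {A : HypArrangement K 3} {X : Submodule K (Fin 3 → K)} :
    X ∈ A.rankTwoFlats ↔ ∃ H₁ ∈ A.planes, ∃ H₂ ∈ A.planes, H₁ ≠ H₂ ∧ H₁ ⊓ H₂ = X := by
  classical
  simp only [rankTwoFlats, Finset.mem_image, Finset.mem_offDiag, Prod.exists]
  constructor
  · rintro ⟨H₁, H₂, ⟨h1, h2, h3⟩, h4⟩
    exact ⟨H₁, h1, H₂, h2, h3, h4⟩
  · rintro ⟨H₁, h1, H₂, h2, h3, h4⟩
    exact ⟨H₁, H₂, ⟨h1, h2, h3⟩, h4⟩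

theorem mem_planesAbove {A : HypArrangement K 3} {X H : Submodule K (Fin 3 → K)} :
    H ∈ A.planesAbove X ↔ H ∈ A.planes ∧ X ≤ H := by
  classical
  exact Finset.mem_filter

theorem finrank_plane (A : HypArrangement K 3) {H : Submodule K (Fin 3 → K)}
    (hH : H ∈ A.planes) : Module.finrank K H = 2 := by
  have := A.codim_one H hH
  omega

theorem finrank_inf_planes (A : HypArrangement K 3) {H₁ H₂ : Submodule K (Fin 3 → K)}
    (h1 : H₁ ∈ A.planes) (h2 : H₂ ∈ A.planes) (hne : H₁ ≠ H₂) :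
    Module.finrank K (H₁ ⊓ H₂ : Submodule K (Fin 3 → K)) = 1 := by
  have e1 := A.finrank_plane h1
  have e2 := A.finrank_plane h2
  have hlt : H₁ ⊓ H₂ < H₁ := by
    refine lt_of_le_of_ne inf_le_left fun h => hne ?_
    exact Submodule.eq_of_le_of_finrank_eq (inf_eq_left.mp h) (e1.trans e2.symm)
  have h3 := Submodule.finrank_lt_finrank_of_lt hlt
  have h4 := Submodule.finrank_sup_add_finrank_inf_eq H₁ H₂
  have h5 := Submodule.finrank_le (H₁ ⊔ H₂)
  rw [Module.finrank_fin_fun] at h5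
  omega

theorem finrank_of_mem_rankTwoFlats {A : HypArrangement K 3} {X : Submodule K (Fin 3 → K)}
    (hX : X ∈ A.rankTwoFlats) : Module.finrank K X = 1 := by
  obtain ⟨H₁, h1, H₂, h2, hne, rfl⟩ := mem_rankTwoFlats.mp hX
  exact A.finrank_inf_planes h1 h2 hne

/-- A line contained in two distinct members of `A` is their intersection. -/
theorem eq_inf_of_le (A : HypArrangement K 3) {X H₁ H₂ : Submodule K (Fin 3 → K)}
    (hX : Module.finrank K X = 1) (h1 : H₁ ∈ A.planes) (h2 : H₂ ∈ A.planes) (hne : H₁ ≠ H₂)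
    (hX1 : X ≤ H₁) (hX2 : X ≤ H₂) : H₁ ⊓ H₂ = X :=
  (Submodule.eq_of_le_of_finrank_eq (le_inf hX1 hX2)
    (hX.trans (A.finrank_inf_planes h1 h2 hne).symm)).symm

theorem mem_lattice {A : HypArrangement K 3} {X : Submodule K (Fin 3 → K)} :
    X ∈ A.lattice ↔ ∃ B ⊆ A.planes, B.inf id = X := by
  classical
  simp [lattice]

theorem top_mem_lattice (A : HypArrangement K 3) : ⊤ ∈ A.lattice :=
  mem_lattice.mpr ⟨∅, Finset.empty_subset _, Finset.inf_empty⟩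

theorem plane_mem_lattice (A : HypArrangement K 3) {H : Submodule K (Fin 3 → K)}
    (hH : H ∈ A.planes) : H ∈ A.lattice :=
  mem_lattice.mpr ⟨{H}, Finset.singleton_subset_iff.mpr hH, Finset.inf_singleton⟩

theorem rankTwoFlat_mem_lattice {A : HypArrangement K 3} {X : Submodule K (Fin 3 → K)}
    (hX : X ∈ A.rankTwoFlats) : X ∈ A.lattice := by
  classical
  obtain ⟨H₁, h1, H₂, h2, -, rfl⟩ := mem_rankTwoFlats.mp hX
  refine mem_lattice.mpr ⟨{H₁, H₂}, ?_, by simp⟩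
  intro H hH
  rcases Finset.mem_insert.mp hH with rfl | hH
  · exact h1
  · rwa [Finset.mem_singleton.mp hH]

theorem exists_plane_of_mem_lattice {A : HypArrangement K 3} {X : Submodule K (Fin 3 → K)}
    (hX : X ∈ A.lattice) (hne : X ≠ ⊤) : ∃ H ∈ A.planes, X ≤ H := by
  obtain ⟨B, hB, rfl⟩ := mem_lattice.mp hX
  obtain ⟨H, hH⟩ : B.Nonempty := by
    rw [Finset.nonempty_iff_ne_empty]
    rintro rfl
    exact hne Finset.inf_empty
  exact ⟨H, hB hH, Finset.inf_le (f := id) hH⟩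

theorem eq_top_of_finrank {X : Submodule K (Fin 3 → K)} (h : Module.finrank K X = 3) : X = ⊤ :=
  Submodule.eq_top_of_finrank_eq (by rw [h, Module.finrank_fin_fun])

theorem ne_top_of_finrank {X : Submodule K (Fin 3 → K)} (h : Module.finrank K X < 3) :
    X ≠ ⊤ := by
  rintro rfl
  rw [finrank_top, Module.finrank_fin_fun] at h
  omega

theorem mem_planes_of_mem_lattice {A : HypArrangement K 3} {X : Submodule K (Fin 3 → K)}
    (hX : X ∈ A.lattice) (h : Module.finrank K X = 2) : X ∈ A.planes := by
  obtain ⟨H, hH, hle⟩ := exists_plane_of_mem_lattice hX (ne_top_of_finrank (by omega))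
  rwa [Submodule.eq_of_le_of_finrank_eq hle (h.trans (A.finrank_plane hH).symm)]

theorem mem_rankTwoFlats_of_mem_lattice {A : HypArrangement K 3} {X : Submodule K (Fin 3 → K)}
    (hX : X ∈ A.lattice) (h : Module.finrank K X = 1) : X ∈ A.rankTwoFlats := by
  obtain ⟨B, hB, rfl⟩ := mem_lattice.mp hX
  obtain ⟨H₁, hH₁⟩ : B.Nonempty := by
    rw [Finset.nonempty_iff_ne_empty]
    rintro rfl
    exact ne_top_of_finrank (h.trans_lt (by omega)) Finset.inf_empty
  obtain ⟨H₂, hH₂, hne⟩ : ∃ H₂ ∈ B, H₁ ≠ H₂ := by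
    by_contra! hall
    have h1 : B.inf id = H₁ :=
      le_antisymm (Finset.inf_le (f := id) hH₁) (Finset.le_inf fun H hH => (hall H hH).le)
    rw [h1, A.finrank_plane (hB hH₁)] at h
    omega
  exact mem_rankTwoFlats.mpr ⟨H₁, hB hH₁, H₂, hB hH₂, hne,
    A.eq_inf_of_le h (hB hH₁) (hB hH₂) hne (Finset.inf_le (f := id) hH₁)
      (Finset.inf_le (f := id) hH₂)⟩

open Classical in
theorem moebius_plane (A : HypArrangement K 3) {H : Submodule K (Fin 3 → K)}
    (hH : H ∈ A.planes) : A.moebius H = -1 := by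
  have h2 := A.finrank_plane hH
  have hne : H ≠ ⊤ := ne_top_of_finrank (by omega)
  have hf : A.lattice.filter (fun Y => H < Y) = {⊤} := by
    ext Y
    simp only [Finset.mem_filter, Finset.mem_singleton]
    constructor
    · rintro ⟨-, hlt⟩
      have h3 := Submodule.finrank_lt_finrank_of_lt hlt
      have h4 := Submodule.finrank_le Y
      rw [Module.finrank_fin_fun] at h4
      exact eq_top_of_finrank (by omega)
    · rintro rfl
      exact ⟨A.top_mem_lattice, hne.lt_top⟩
  rw [A.moebius_of_ne_top hne, hf, Finset.sum_singleton, moebius_top]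

open Classical in
theorem moebius_rankTwoFlat {A : HypArrangement K 3} {X : Submodule K (Fin 3 → K)}
    (hX : X ∈ A.rankTwoFlats) : A.moebius X = ((A.planesAbove X).card - 1 : ℕ) := by
  have h1 := finrank_of_mem_rankTwoFlats hX
  have hne : X ≠ ⊤ := ne_top_of_finrank (by omega)
  have hf : A.lattice.filter (fun Y => X < Y) = insert ⊤ (A.planesAbove X) := by
    ext Y
    simp only [Finset.mem_filter, Finset.mem_insert, mem_planesAbove]
    constructor
    · rintro ⟨hY, hlt⟩
      have h3 := Submodule.finrank_lt_finrank_of_lt hlt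
      have h4 := Submodule.finrank_le Y
      rw [Module.finrank_fin_fun] at h4
      by_cases h5 : Module.finrank K Y = 3
      · exact Or.inl (eq_top_of_finrank h5)
      · exact Or.inr ⟨mem_planes_of_mem_lattice hY (by omega), hlt.le⟩
    · rintro (rfl | ⟨hY, hle⟩)
      · exact ⟨A.top_mem_lattice, hne.lt_top⟩
      · refine ⟨A.plane_mem_lattice hY, lt_of_le_of_ne hle ?_⟩
        rintro rfl
        rw [A.finrank_plane hY] at h1
        omega
  have htop : (⊤ : Submodule K (Fin 3 → K)) ∉ A.planesAbove X := fun h => by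
    have h2 := A.finrank_plane (mem_planesAbove.mp h).1
    rw [finrank_top, Module.finrank_fin_fun] at h2
    omega
  have hpos : 0 < (A.planesAbove X).card := by
    obtain ⟨H₁, hH₁, H₂, -, -, rfl⟩ := mem_rankTwoFlats.mp hX
    exact Finset.card_pos.mpr ⟨H₁, mem_planesAbove.mpr ⟨hH₁, inf_le_left⟩⟩
  rw [A.moebius_of_ne_top hne, hf, Finset.sum_insert htop, moebius_top,
    Finset.sum_congr rfl fun H hH => A.moebius_plane (mem_planesAbove.mp hH).1,
    Finset.sum_const, Nat.cast_sub (by omega)]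
  simp
  ring

open Classical in
theorem coeff_charPoly (A : HypArrangement K 3) (d : ℕ) :
    A.charPoly.coeff d =
      ∑ Z ∈ A.lattice.filter (fun Y : Submodule K (Fin 3 → K) => Module.finrank K Y = d),
        A.moebius Z := by
  rw [charPoly, finsetSum_coeff, Finset.sum_filter]
  refine Finset.sum_congr rfl fun X _ => ?_
  rw [coeff_C_mul_X_pow]
  exact if_congr eq_comm rfl rfl

theorem coeff_two_charPoly (A : HypArrangement K 3) :
    A.charPoly.coeff 2 = -(A.planes.card : ℤ) := by
  classical
  have hf : A.lattice.filter (fun Y : Submodule K (Fin 3 → K) => Module.finrank K Y = 2)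
      = A.planes := by
    ext X
    rw [Finset.mem_filter]
    exact ⟨fun h => mem_planes_of_mem_lattice h.1 h.2,
      fun h => ⟨A.plane_mem_lattice h, A.finrank_plane h⟩⟩
  rw [coeff_charPoly, hf, Finset.sum_congr rfl fun H hH => A.moebius_plane hH]
  simp

theorem coeff_one_charPoly (A : HypArrangement K 3) :
    A.charPoly.coeff 1 = (A.secondBetti : ℤ) := by
  classical
  have hf : A.lattice.filter (fun Y : Submodule K (Fin 3 → K) => Module.finrank K Y = 1)
      = A.rankTwoFlats := by
    ext X
    rw [Finset.mem_filter]
    exact ⟨fun h => mem_rankTwoFlats_of_mem_lattice h.1 h.2,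
      fun h => ⟨rankTwoFlat_mem_lattice h, finrank_of_mem_rankTwoFlats h⟩⟩
  rw [coeff_charPoly, hf, secondBetti, Nat.cast_sum]
  exact Finset.sum_congr rfl fun X hX => moebius_rankTwoFlat hX

/-- The roots of the reduced characteristic polynomial determine the number of planes and the
second Betti number. -/
theorem roots_charPoly₀ (A : HypArrangement K 3) (hA : A.planes.Nonempty) {c d : ℤ}
    (h : A.charPoly₀ = (X - C c) * (X - C d)) :
    c + d + 1 = A.planes.card ∧ c * d + c + d = A.secondBetti := by
  have h1 := A.sub_one_mul_charPoly₀ hA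
  have h2 : A.charPoly = X ^ 3 + C (-(c + d + 1)) * X ^ 2 + C (c * d + c + d) * X
      + C (-(c * d)) := by
    rw [← h1, h]
    simp only [map_neg, map_add, map_mul, map_one]
    ring
  have c2 := A.coeff_two_charPoly
  have c1 := A.coeff_one_charPoly
  rw [h2] at c1 c2
  simp only [coeff_add, coeff_X_pow, coeff_C_mul, coeff_C, coeff_X] at c1 c2
  norm_num at c1 c2
  constructor <;> linarith

theorem charPoly₀_of_isEmpty (A : HypArrangement K 3) (hA : A.planes = ∅) :
    A.charPoly₀ = X ^ 2 + X + 1 := by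
  classical
  have h : A.charPoly = X ^ 3 := by
    have hl : A.lattice = {⊤} := by
      rw [lattice, hA, Finset.powerset_empty, Finset.image_singleton, Finset.inf_empty]
    rw [charPoly, hl, Finset.sum_singleton, moebius_top, finrank_top, Module.finrank_fin_fun,
      map_one, one_mul]
  refine (div_modByMonic_unique (X ^ 2 + X + 1 : ℤ[X]) 1 (monic_X_sub_C 1) ⟨?_, ?_⟩).1
  · rw [h, map_one]
    ring
  · rw [degree_X_sub_C, degree_one]
    exact zero_lt_one

/-! ### Deletion of a plane -/

theorem planes_delete [DecidableEq (Submodule K (Fin 3 → K))] (A : HypArrangement K 3)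
    (H : Submodule K (Fin 3 → K)) : (A.delete H).planes = A.planes.erase H := by
  ext L
  simp [delete]

theorem mem_planes_delete {A : HypArrangement K 3} {H L : Submodule K (Fin 3 → K)} :
    L ∈ (A.delete H).planes ↔ L ≠ H ∧ L ∈ A.planes := by
  classical
  rw [planes_delete, Finset.mem_erase]

theorem card_planes_delete (A : HypArrangement K 3) {H : Submodule K (Fin 3 → K)}
    (hH : H ∈ A.planes) : (A.delete H).planes.card + 1 = A.planes.card := by
  classical
  rw [planes_delete, Finset.card_erase_add_one hH]

open Classical in
/-- The second Betti number drops by the number of lines that the other planes cut out on the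
deleted plane. -/
theorem secondBetti_delete (A : HypArrangement K 3) {H : Submodule K (Fin 3 → K)}
    (hH : H ∈ A.planes) :
    A.secondBetti = (A.delete H).secondBetti
      + ((A.delete H).planes.image fun L => L ⊓ H).card := by
  set T := (A.delete H).planes.image fun L => L ⊓ H with hT
  have hsub : (A.delete H).rankTwoFlats ⊆ A.rankTwoFlats := by
    intro X hX
    obtain ⟨H₁, h1, H₂, h2, hne, rfl⟩ := mem_rankTwoFlats.mp hX
    exact mem_rankTwoFlats.mpr ⟨H₁, (mem_planes_delete.mp h1).2, H₂, (mem_planes_delete.mp h2).2,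
      hne, rfl⟩
  have hTsub : T ⊆ A.rankTwoFlats := by
    intro X hX
    obtain ⟨L, hL, rfl⟩ := Finset.mem_image.mp hX
    obtain ⟨h1, h2⟩ := mem_planes_delete.mp hL
    exact mem_rankTwoFlats.mpr ⟨L, h2, H, hH, h1, rfl⟩
  have hTmem : ∀ X ∈ A.rankTwoFlats, (X ∈ T ↔ X ≤ H) := by
    intro X hX
    constructor
    · intro h
      obtain ⟨L, -, rfl⟩ := Finset.mem_image.mp h
      exact inf_le_right
    · intro hle
      obtain ⟨L, hL, hne, hXL⟩ : ∃ L ∈ A.planes, L ≠ H ∧ X ≤ L := by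
        obtain ⟨H₁, h1, H₂, h2, hne, rfl⟩ := mem_rankTwoFlats.mp hX
        by_cases h : H₁ = H
        · exact ⟨H₂, h2, fun h' => hne (h.trans h'.symm), inf_le_right⟩
        · exact ⟨H₁, h1, h, inf_le_left⟩
      exact Finset.mem_image.mpr ⟨L, mem_planes_delete.mpr ⟨hne, hL⟩,
        A.eq_inf_of_le (finrank_of_mem_rankTwoFlats hX) hL hH hne hXL hle⟩
  have hdel : (A.delete H).secondBetti
      = ∑ X ∈ A.rankTwoFlats, (((A.delete H).planesAbove X).card - 1) := by
    refine Finset.sum_subset hsub fun X hX hX' => ?_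
    rw [Nat.sub_eq_zero_iff_le, Finset.card_le_one]
    intro H₁ h1 H₂ h2
    by_contra hne
    rw [mem_planesAbove] at h1 h2
    exact hX' (mem_rankTwoFlats.mpr ⟨H₁, h1.1, H₂, h2.1, hne,
      (A.delete H).eq_inf_of_le (finrank_of_mem_rankTwoFlats hX) h1.1 h2.1 hne h1.2 h2.2⟩)
  have hcard : T.card = ∑ X ∈ A.rankTwoFlats, if X ∈ T then 1 else 0 := by
    rw [← Finset.sum_filter, Finset.filter_mem_eq_inter, Finset.inter_eq_right.mpr hTsub,
      Finset.card_eq_sum_ones]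
  rw [hdel, hcard, ← Finset.sum_add_distrib, secondBetti]
  refine Finset.sum_congr rfl fun X hX => ?_
  by_cases hXH : X ≤ H
  · rw [if_pos ((hTmem X hX).mpr hXH)]
    have h1 : A.planesAbove X = insert H ((A.delete H).planesAbove X) := by
      ext L
      rw [Finset.mem_insert, mem_planesAbove, mem_planesAbove, mem_planes_delete]
      by_cases hL : L = H
      · simp [hL, hH, hXH]
      · simp [hL]
    have h2 : H ∉ (A.delete H).planesAbove X := fun h =>
      (mem_planes_delete.mp (mem_planesAbove.mp h).1).1 rfl
    obtain ⟨L, hL, hLX⟩ := Finset.mem_image.mp ((hTmem X hX).mpr hXH)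
    have h3 : 0 < ((A.delete H).planesAbove X).card :=
      Finset.card_pos.mpr ⟨L, mem_planesAbove.mpr ⟨hL, hLX ▸ inf_le_left⟩⟩
    rw [h1, Finset.card_insert_of_notMem h2]
    omega
  · rw [if_neg fun h => hXH ((hTmem X hX).mp h), add_zero]
    congr 2
    ext L
    rw [mem_planesAbove, mem_planesAbove, mem_planes_delete]
    constructor
    · rintro ⟨h1, h2⟩
      exact ⟨⟨fun h => hXH (h ▸ h2), h1⟩, h2⟩
    · rintro ⟨⟨-, h1⟩, h2⟩
      exact ⟨h1, h2⟩

/-! ### The Hilbert function of the logarithmic derivation module -/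

/-- The `K`-space of the logarithmic derivations whose coefficients are forms of degree `k`. -/
noncomputable def gradedLogDer (A : HypArrangement K ℓ) (k : ℕ) :
    Submodule K (Fin ℓ → MvPolynomial (Fin ℓ) K) :=
  A.logDer.restrictScalars K ⊓
    Submodule.pi Set.univ fun _ => MvPolynomial.homogeneousSubmodule (Fin ℓ) K k

theorem mem_gradedLogDer {A : HypArrangement K ℓ} {k : ℕ}
    {θ : Fin ℓ → MvPolynomial (Fin ℓ) K} :
    θ ∈ A.gradedLogDer k ↔ θ ∈ A.logDer ∧ ∀ i, (θ i).IsHomogeneous k := by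
  simp [gradedLogDer, Submodule.mem_pi]

/-- A homogeneous basis of `D(A)` with degrees `d i` decomposes the graded pieces. -/
theorem exists_gradedLogDer_equiv (A : HypArrangement K ℓ) {d : Fin ℓ → ℕ}
    (hA : A.IsFreeWithExp d) {k : ℕ} (hk : ∀ i, d i ≤ k) :
    Nonempty ((∀ i, MvPolynomial.homogeneousSubmodule (Fin ℓ) K (k - d i))
      ≃ₗ[K] A.gradedLogDer k) := by
  obtain ⟨θ, hθ⟩ := hA
  let ψ : (∀ i, MvPolynomial.homogeneousSubmodule (Fin ℓ) K (k - d i)) →ₗ[K] A.gradedLogDer k :=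
    { toFun := fun f => ⟨∑ i, (f i : MvPolynomial (Fin ℓ) K) •
          (θ i : Fin ℓ → MvPolynomial (Fin ℓ) K), by
        rw [mem_gradedLogDer]
        refine ⟨Submodule.sum_mem _ fun i _ => Submodule.smul_mem _ _ (θ i).2, fun j => ?_⟩
        rw [Finset.sum_apply]
        refine MvPolynomial.IsHomogeneous.sum _ _ _ fun i _ => ?_
        have h1 : (f i : MvPolynomial (Fin ℓ) K).IsHomogeneous (k - d i) := (f i).2
        have h2 := h1.mul (hθ i j)
        rwa [Nat.sub_add_cancel (hk i)] at h2⟩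
      map_add' := fun f g => by
        ext1
        simp [add_smul, Finset.sum_add_distrib]
      map_smul' := fun c f => by
        ext1
        simp [Finset.smul_sum] }
  have hψ : ∀ f, (ψ f : Fin ℓ → MvPolynomial (Fin ℓ) K) = ∑ i, (f i : MvPolynomial (Fin ℓ) K) •
      (θ i : Fin ℓ → MvPolynomial (Fin ℓ) K) := fun f => rfl
  refine ⟨LinearEquiv.ofBijective ψ ⟨?_, ?_⟩⟩
  · rw [← LinearMap.ker_eq_bot, LinearMap.ker_eq_bot']
    intro f hf
    have h1 : ∑ i, (f i : MvPolynomial (Fin ℓ) K) • θ i = 0 := by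
      ext1
      have h2 := congrArg Subtype.val hf
      rw [hψ] at h2
      simpa using h2
    funext i
    ext1
    exact Fintype.linearIndependent_iff.mp θ.linearIndependent _ h1 i
  · rintro ⟨η, hη⟩
    rw [mem_gradedLogDer] at hη
    let f := θ.repr ⟨η, hη.1⟩
    have hf : η = ∑ i, f i • (θ i : Fin ℓ → MvPolynomial (Fin ℓ) K) := by
      have h1 := congrArg Subtype.val (θ.sum_repr ⟨η, hη.1⟩)
      rw [Submodule.coe_sum] at h1
      exact h1.symm
    refine ⟨fun i => ⟨MvPolynomial.homogeneousComponent (k - d i) (f i),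
      MvPolynomial.homogeneousComponent_isHomogeneous _ _⟩, ?_⟩
    ext1
    rw [hψ]
    funext j
    -- only the component of degree `k` of the expansion of `η j` survives
    have hj : η j = MvPolynomial.homogeneousComponent k
        ((∑ i, f i • (θ i : Fin ℓ → MvPolynomial (Fin ℓ) K)) j) := by
      rw [← hf, MvPolynomial.homogeneousComponent_eq_self (hη.2 j)]
    change _ = η j
    rw [hj, Finset.sum_apply, Finset.sum_apply, map_sum]
    refine Finset.sum_congr rfl fun i _ => ?_
    rw [Pi.smul_apply, Pi.smul_apply, smul_eq_mul, smul_eq_mul,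
      homogeneousComponent_mul_right _ _ (hθ i j) (hk i)]

theorem finrank_gradedLogDer_of_isFree (A : HypArrangement K ℓ) {d : Fin ℓ → ℕ}
    (hA : A.IsFreeWithExp d) {k : ℕ} (hk : ∀ i, d i ≤ k) :
    Module.finrank K (A.gradedLogDer k)
      = ∑ i, Module.finrank K (MvPolynomial.homogeneousSubmodule (Fin ℓ) K (k - d i)) := by
  obtain ⟨φ⟩ := A.exists_gradedLogDer_equiv hA hk
  rw [← φ.finrank_eq, Module.finrank_pi_fintype]

/-- The empty arrangement is free: all derivations are logarithmic. -/
theorem isFreeWithExp_of_isEmpty (A : HypArrangement K ℓ) (hA : A.planes = ∅) :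
    A.IsFreeWithExp fun _ => 0 := by
  have htop : A.logDer = ⊤ := by
    refine Submodule.eq_top_iff'.mpr fun θ => ?_
    rw [mem_logDer_iff, hA]
    simp
  refine ⟨(Pi.basisFun (MvPolynomial (Fin ℓ) K) (Fin ℓ)).map
    (LinearEquiv.ofTop _ htop).symm, fun i j => ?_⟩
  have h : ((((Pi.basisFun (MvPolynomial (Fin ℓ) K) (Fin ℓ)).map
      (LinearEquiv.ofTop _ htop).symm) i : A.logDer) : Fin ℓ → MvPolynomial (Fin ℓ) K)
      = Pi.single i 1 := by
    simp
  rw [h, Pi.single_apply]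
  split_ifs
  · exact MvPolynomial.isHomogeneous_one _ _
  · exact MvPolynomial.isHomogeneous_zero _ _ _

instance finiteDimensional_gradedLogDer (A : HypArrangement K ℓ) (k : ℕ) :
    FiniteDimensional K (A.gradedLogDer k) := by
  let E : HypArrangement K ℓ := ⟨∅, by simp⟩
  obtain ⟨φ⟩ := E.exists_gradedLogDer_equiv (E.isFreeWithExp_of_isEmpty rfl) (k := k)
    fun _ => Nat.zero_le _
  have hE : FiniteDimensional K (E.gradedLogDer k) := φ.finiteDimensional
  refine Submodule.finiteDimensional_of_le (S₂ := E.gradedLogDer k) fun θ hθ => ?_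
  rw [mem_gradedLogDer] at hθ ⊢
  exact ⟨(mem_logDer_iff _ _).mpr (by simp [E]), hθ.2⟩

/-- The map `θ ↦ θ(α)` followed by restriction to the plane `ker α`. -/
noncomputable def resDer {α : Module.Dual K (Fin 3 → K)} (F : PlaneFrame α) :
    (Fin 3 → MvPolynomial (Fin 3) K) →ₗ[K] MvPolynomial (Fin 2) K :=
  F.res.toLinearMap ∘ₗ (derForm α).restrictScalars K

theorem resDer_apply {α : Module.Dual K (Fin 3 → K)} (F : PlaneFrame α)
    (θ : Fin 3 → MvPolynomial (Fin 3) K) : resDer F θ = F.res (derForm α θ) := rfl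

/-- Adding the plane `ker α` to an arrangement cuts `D` down to the kernel of `resDer`. -/
theorem finrank_gradedLogDer_delete (A : HypArrangement K 3) {α : Module.Dual K (Fin 3 → K)}
    (hα : LinearMap.ker α ∈ A.planes) (F : PlaneFrame α) (k : ℕ) :
    Module.finrank K (((A.delete (LinearMap.ker α)).gradedLogDer k).map (resDer F))
      + Module.finrank K (A.gradedLogDer k)
      = Module.finrank K ((A.delete (LinearMap.ker α)).gradedLogDer k) := by
  set D' := (A.delete (LinearMap.ker α)).gradedLogDer k
  have hmem : ∀ θ, θ ∈ A.gradedLogDer k ↔ θ ∈ D' ∧ resDer F θ = 0 := fun θ => by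
    rw [mem_gradedLogDer, mem_gradedLogDer, A.mem_logDer_iff_delete hα, resDer_apply,
      F.res_eq_zero_iff]
    tauto
  have hle : A.gradedLogDer k ≤ D' := fun θ hθ => ((hmem θ).mp hθ).1
  have hker : LinearMap.ker ((resDer F).domRestrict D')
      = (A.gradedLogDer k).comap D'.subtype := by
    ext ⟨θ, hθ⟩
    rw [LinearMap.mem_ker, LinearMap.domRestrict_apply, Submodule.mem_comap,
      Submodule.subtype_apply, hmem]
    exact ⟨fun h => ⟨hθ, h⟩, fun h => h.2⟩
  have h := LinearMap.finrank_range_add_finrank_ker ((resDer F).domRestrict D')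
  rwa [hker, LinearMap.range_domRestrict,
    (Submodule.comapSubtypeEquivOfLe hle).finrank_eq] at h

theorem finrank_map_resDer_le (A : HypArrangement K 3) {α : Module.Dual K (Fin 3 → K)}
    (hα : LinearMap.ker α ∉ A.planes) (F : PlaneFrame α) {k : ℕ} (hk : A.planes.card ≤ k) :
    Module.finrank K ((A.gradedLogDer k).map (resDer F))
      ≤ k - (A.planes.card - (A.traces F).card) + 1 := by
  have hle : (A.gradedLogDer k).map (resDer F)
      ≤ formMultiples (A.teraoPoly F) (k - (A.planes.card - (A.traces F).card)) := by
    rintro _ ⟨θ, hθ, rfl⟩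
    have h1 := mem_gradedLogDer.mp hθ
    exact mem_formMultiples (A.teraoPoly_isHomogeneous F)
      (F.res_isHomogeneous (derForm_isHomogeneous α h1.2)) (by omega)
      (A.teraoPoly_dvd hα F h1.1)
  refine (Submodule.finrank_mono hle).trans_eq ?_
  rw [finrank_formMultiples (A.teraoPoly_ne_zero hα F), finrank_homogeneousSubmodule_two]

theorem le_finrank_map_resDer (A : HypArrangement K 3) {α : Module.Dual K (Fin 3 → K)}
    (hα : LinearMap.ker α ∉ A.planes) (F : PlaneFrame α) {k : ℕ} (hk : A.planes.card ≤ k) :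
    k - A.planes.card + 1 ≤ Module.finrank K ((A.gradedLogDer k).map (resDer F)) := by
  have hle : formMultiples (F.res A.defPoly) (k - A.planes.card)
      ≤ (A.gradedLogDer k).map (resDer F) := by
    rintro _ ⟨g, hg, rfl⟩
    have hg' : g.IsHomogeneous (k - A.planes.card) := hg
    refine ⟨A.defPoly • pullback F.π g • constDer F.v, mem_gradedLogDer.mpr
      ⟨A.defPoly_smul_mem_logDer _, fun i => ?_⟩, ?_⟩
    · have h1 := A.defPoly_isHomogeneous.mul ((pullback_isHomogeneous F.π hg').mul
        (MvPolynomial.isHomogeneous_C (Fin 3) (F.v i)))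
      rwa [add_zero, Nat.add_sub_cancel' hk] at h1
    · have h1 : derForm α (A.defPoly • pullback F.π g • constDer F.v)
          = A.defPoly * pullback F.π g := by
        rw [map_smul, map_smul, derForm_constDer, F.apply_v, map_one, smul_eq_mul, smul_eq_mul,
          mul_one]
      rw [resDer_apply, h1, map_mul, F.res_pullback, LinearMap.mulLeft_apply]
  refine le_trans (le_of_eq ?_) (Submodule.finrank_mono hle)
  rw [finrank_formMultiples (A.res_defPoly_ne_zero hα F), finrank_homogeneousSubmodule_two]

/-- For every arrangement, the dimension of `D(A)_k` lies between two quadratic polynomials in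
`k` that differ by the second Betti number. -/
theorem finrank_gradedLogDer_bounds (n : ℕ) : ∀ A : HypArrangement K 3, A.planes.card = n →
    ∀ k : ℕ, n ≤ k →
      (3 * (k + 1) * (k + 2) - 2 * n * (k + 1) + n * (n - 1) - 2 * A.secondBetti : ℤ)
        ≤ 2 * Module.finrank K (A.gradedLogDer k) ∧
      (2 * Module.finrank K (A.gradedLogDer k) : ℤ)
        ≤ 3 * (k + 1) * (k + 2) - 2 * n * (k + 1) + n * (n - 1) := by
  induction n with
  | zero =>
    intro A hA k _
    have h := A.finrank_gradedLogDer_of_isFree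
      (A.isFreeWithExp_of_isEmpty (Finset.card_eq_zero.mp hA)) (k := k) fun _ => Nat.zero_le _
    have h2 := two_mul_finrank_homogeneousSubmodule_three (K := K) k
    simp only [Nat.sub_zero, Finset.sum_const, Finset.card_univ, Fintype.card_fin,
      smul_eq_mul] at h
    zify at h h2
    have hb : (0 : ℤ) ≤ A.secondBetti := Int.natCast_nonneg _
    rw [h]
    push_cast
    constructor <;> nlinarith
  | succ n ih =>
    intro A hA k hk
    obtain ⟨H, hH⟩ : A.planes.Nonempty := Finset.card_pos.mp (by omega)
    obtain ⟨α, hα0, rfl⟩ := A.exists_form hH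
    obtain ⟨F⟩ := exists_planeFrame hα0
    have hc := A.card_planes_delete hH
    have hα : LinearMap.ker α ∉ (A.delete (LinearMap.ker α)).planes :=
      fun h => (mem_planes_delete.mp h).1 rfl
    have hn : (A.delete (LinearMap.ker α)).planes.card = n := by omega
    obtain ⟨h1, h2⟩ := ih _ hn k (by omega)
    have h3 := A.finrank_gradedLogDer_delete hH F k
    have h4 := finrank_map_resDer_le _ hα F (k := k) (by omega)
    have h5 := le_finrank_map_resDer _ hα F (k := k) (by omega)
    have h6 := A.secondBetti_delete hH
    have h7 := (A.delete (LinearMap.ker α)).card_traces F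
    have h8 := (A.delete (LinearMap.ker α)).sum_card_planesOver F
    rw [← h7] at h6
    have h9 : (Module.finrank K
        (((A.delete (LinearMap.ker α)).gradedLogDer k).map (resDer F)) : ℤ)
        ≤ k - (n - ((A.delete (LinearMap.ker α)).traces F).card) + 1 := by
      omega
    have h10 : (k - n + 1 : ℤ) ≤ Module.finrank K
        (((A.delete (LinearMap.ker α)).gradedLogDer k).map (resDer F)) := by
      omega
    zify at h3 h6
    push_cast
    constructor <;> nlinarith

/-- The exponents of a free arrangement sum to the number of planes. Their second elementary
symmetric function is at most the second Betti number. -/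
theorem exponents_of_isFree (A : HypArrangement K 3) {p q r : ℕ}
    (hA : A.IsFreeWithExp ![p, q, r]) :
    p + q + r = A.planes.card ∧ p * q + p * r + q * r ≤ A.secondBetti := by
  have hdim : ∀ k : ℕ, p ≤ k → q ≤ k → r ≤ k →
      (2 * Module.finrank K (A.gradedLogDer k) : ℤ)
        = (k - p + 1) * (k - p + 2) + (k - q + 1) * (k - q + 2) + (k - r + 1) * (k - r + 2) := by
    intro k hp hq hr
    have h := A.finrank_gradedLogDer_of_isFree hA (k := k) (by
      intro i
      fin_cases i <;> assumption)
    have h2 := fun j => two_mul_finrank_homogeneousSubmodule_three (K := K) j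
    rw [Fin.sum_univ_three] at h
    have h3 : 2 * Module.finrank K (A.gradedLogDer k)
        = (k - p + 1) * (k - p + 2) + (k - q + 1) * (k - q + 2) + (k - r + 1) * (k - r + 2) := by
      rw [h, mul_add, mul_add, h2, h2, h2]
      rfl
    have h4 := congrArg (Nat.cast : ℕ → ℤ) h3
    push_cast [Nat.cast_sub hp, Nat.cast_sub hq, Nat.cast_sub hr] at h4
    exact h4
  set n := A.planes.card with hn
  have hbd := fun k hk => finrank_gradedLogDer_bounds n A rfl k hk
  -- comparison of the terms linear in `k`, for a single large `k`
  have hsum : p + q + r = n := by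
    set N := n + p + q + r + A.secondBetti with hN
    set k := (N + 1) ^ 2 + N with hk
    have hNk : N ≤ k := by omega
    obtain ⟨h1, h2⟩ := hbd k (by omega)
    rw [hdim k (by omega) (by omega) (by omega)] at h1 h2
    have hkN : (k : ℤ) = (N + 1) ^ 2 + N := by
      rw [hk]
      push_cast
      ring
    have hNz : (N : ℤ) = n + p + q + r + A.secondBetti := by
      rw [hN]
      push_cast
      ring
    have hb : (0 : ℤ) ≤ A.secondBetti := Int.natCast_nonneg _
    have hn0 : (0 : ℤ) ≤ n := Int.natCast_nonneg _
    have hp0 : (0 : ℤ) ≤ p := Int.natCast_nonneg _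
    have hq0 : (0 : ℤ) ≤ q := Int.natCast_nonneg _
    have hr0 : (0 : ℤ) ≤ r := Int.natCast_nonneg _
    have hpq := mul_nonneg hp0 hq0
    have hpr := mul_nonneg hp0 hr0
    have hqr := mul_nonneg hq0 hr0
    generalize (A.secondBetti : ℤ) = B at *
    rcases lt_trichotomy (p + q + r) n with hlt | heq | hgt
    · exfalso
      have h3 : (p + q + r + 1 : ℤ) ≤ n := by exact_mod_cast hlt
      have h4 : (0 : ℤ) ≤ (n - (p + q + r) - 1) * (2 * k + 3) :=
        mul_nonneg (by linarith) (by positivity)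
      nlinarith
    · exact heq
    · exfalso
      have h3 : (n + 1 : ℤ) ≤ p + q + r := by exact_mod_cast hgt
      have h4 : (0 : ℤ) ≤ ((p + q + r) - n - 1) * (2 * k + 3) :=
        mul_nonneg (by linarith) (by positivity)
      nlinarith
  refine ⟨hsum, ?_⟩
  obtain ⟨h1, -⟩ := hbd n le_rfl
  rw [hdim n (by omega) (by omega) (by omega)] at h1
  zify at hsum ⊢
  rw [← hsum] at h1
  nlinarith

/-! ### The number of lines cut out on a plane -/

theorem res_eq_zero_of_basis (A : HypArrangement K 3)
    (θ : Module.Basis (Fin 3) (MvPolynomial (Fin 3) K) A.logDer)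
    {α : Module.Dual K (Fin 3 → K)} (F : PlaneFrame α)
    (W : (Fin 3 → MvPolynomial (Fin 3) K) →ₗ[MvPolynomial (Fin 3) K] MvPolynomial (Fin 3) K)
    (h : ∀ i, F.res (W (θ i)) = 0) {η : Fin 3 → MvPolynomial (Fin 3) K} (hη : η ∈ A.logDer) :
    F.res (W η) = 0 := by
  have h1 := congrArg Subtype.val (θ.sum_repr ⟨η, hη⟩)
  rw [Submodule.coe_sum] at h1
  rw [← show _ = η from h1, map_sum, map_sum]
  refine Finset.sum_eq_zero fun i _ => ?_
  rw [Submodule.coe_smul, map_smul, smul_eq_mul, map_mul, h, mul_zero]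

theorem traces_nonempty (A : HypArrangement K 3) (hA : A.planes.Nonempty)
    {α : Module.Dual K (Fin 3 → K)} (F : PlaneFrame α) : 0 < (A.traces F).card := by
  classical
  exact Finset.card_pos.mpr (hA.image _)

/-- A plane outside a free arrangement with exponents `(1, a, b)` meets it in more than `a` lines:
otherwise the degree of Terao's polynomial exceeds all the exponents, so every logarithmic
derivation is tangent to the plane, which is false. -/
theorem lt_card_traces_of_isFree (A : HypArrangement K 3) {α : Module.Dual K (Fin 3 → K)}
    (hα : LinearMap.ker α ∉ A.planes) (F : PlaneFrame α) {a b : ℕ} (hab : a ≤ b)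
    (hA : A.IsFreeWithExp ![1, a, b]) : a < (A.traces F).card := by
  by_contra! hcon
  obtain ⟨hn, -⟩ := A.exponents_of_isFree hA
  have hpos := A.traces_nonempty (Finset.card_pos.mp (by omega)) F
  obtain ⟨θ, hθ⟩ := hA
  have hbasis : ∀ i, F.res (derForm α (θ i)) = 0 := fun i => by
    refine eq_zero_of_dvd_of_degree_lt (A.teraoPoly_isHomogeneous F)
      (F.res_isHomogeneous (derForm_isHomogeneous α (hθ i))) ?_ (A.teraoPoly_dvd hα F (θ i).2)
    have hi : ![1, a, b] i ≤ b := by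
      fin_cases i
      · change 1 ≤ b
        omega
      · exact hab
      · exact le_rfl
    omega
  have h := A.res_eq_zero_of_basis θ F (derForm α) hbasis
    (A.defPoly_smul_mem_logDer (constDer F.v))
  rw [map_smul, derForm_constDer, F.apply_v, map_one, smul_eq_mul, mul_one] at h
  exact A.res_defPoly_ne_zero hα F h

/-- The coordinate forms on `K³` given by the projection of a frame. -/
noncomputable def PlaneFrame.coord {α : Module.Dual K (Fin 3 → K)} (F : PlaneFrame α)
    (j : Fin 2) : Module.Dual K (Fin 3 → K) :=
  LinearMap.proj j ∘ₗ F.π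

theorem PlaneFrame.coord_comp_e {α : Module.Dual K (Fin 3 → K)} (F : PlaneFrame α) (j : Fin 2) :
    F.coord j ∘ₗ F.e = LinearMap.proj j := by
  rw [coord, LinearMap.comp_assoc, F.π_e, LinearMap.comp_id]

/-- The determinant of a derivation and the Euler derivation in the coordinates of the plane of a
frame. -/
noncomputable def eulerDet {α : Module.Dual K (Fin 3 → K)} (F : PlaneFrame α) :
    (Fin 3 → MvPolynomial (Fin 3) K) →ₗ[MvPolynomial (Fin 3) K] MvPolynomial (Fin 3) K :=
  linPoly (F.coord 0) • derForm (F.coord 1) - linPoly (F.coord 1) • derForm (F.coord 0)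

theorem eulerDet_apply {α : Module.Dual K (Fin 3 → K)} (F : PlaneFrame α)
    (θ : Fin 3 → MvPolynomial (Fin 3) K) :
    eulerDet F θ = linPoly (F.coord 0) * derForm (F.coord 1) θ
      - linPoly (F.coord 1) * derForm (F.coord 0) θ := rfl

theorem linPoly_trace_dvd_res_eulerDet (A : HypArrangement K 3) {α : Module.Dual K (Fin 3 → K)}
    (hα : LinearMap.ker α ∈ A.planes) (F : PlaneFrame α)
    {θ : Fin 3 → MvPolynomial (Fin 3) K} (hθ : θ ∈ A.logDer) {Y : Submodule K (Fin 2 → K)}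
    (hY : Y ∈ (A.delete (LinearMap.ker α)).traces F) :
    linPoly (planeForm Y) ∣ F.res (eulerDet F θ) := by
  have hα' : LinearMap.ker α ∉ (A.delete (LinearMap.ker α)).planes :=
    fun h => (mem_planes_delete.mp h).1 rfl
  obtain ⟨-, hker⟩ := planeForm_trace_spec _ hα' F hY
  obtain ⟨H, hH, hHY⟩ := exists_of_mem_traces hY
  set γ := planeForm H with hγ
  have hγ0 : γ ∘ₗ F.e ≠ 0 := comp_e_planeForm_ne_zero _ hα' F hH
  have hdvd : linPoly (planeForm Y) ∣ linPoly (γ ∘ₗ F.e) := by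
    obtain ⟨c, hc⟩ := exists_eq_smul_of_ker_le (α := planeForm Y) (β := γ ∘ₗ F.e)
      (by rw [hker, ker_planeForm_comp_e _ F hH, hHY])
    rw [hc, linPoly_smul]
    exact Dvd.intro_left _ rfl
  refine hdvd.trans ?_
  obtain ⟨h1, h2⟩ := (A.mem_logDer_iff_delete hα θ).mp hθ
  have h3 : linPoly (γ ∘ₗ F.e) ∣ F.res (derForm γ θ) := by
    rw [← F.res_linPoly]
    exact map_dvd F.res ((mem_logDer_iff _ θ).mp h1 H hH)
  have h4 : F.res (derForm α θ) = 0 := (F.res_eq_zero_iff _).mpr h2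
  set p := (γ ∘ₗ F.e) (Pi.single 0 1)
  set q := (γ ∘ₗ F.e) (Pi.single 1 1)
  set r := γ F.v
  have hdecomp : γ = p • F.coord 0 + q • F.coord 1 + r • α := by
    conv_lhs => rw [F.form_decomp γ]
    congr 1
    refine LinearMap.ext fun x => ?_
    rw [LinearMap.comp_apply, dual_apply_eq_sum (γ ∘ₗ F.e) (F.π x), Fin.sum_univ_two]
    simp only [PlaneFrame.coord, LinearMap.add_apply, LinearMap.smul_apply, LinearMap.comp_apply,
      LinearMap.proj_apply, smul_eq_mul]
    change _ * p + _ * q = _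
    ring
  have hres : linPoly (γ ∘ₗ F.e) = MvPolynomial.C p * F.res (linPoly (F.coord 0))
      + MvPolynomial.C q * F.res (linPoly (F.coord 1)) := by
    have h5 := congrArg (fun δ => F.res (linPoly δ)) hdecomp
    simp only [linPoly_add, linPoly_smul, map_add, map_mul, F.res_self, mul_zero, add_zero] at h5
    rw [F.res_linPoly γ] at h5
    rw [h5]
    simp [PlaneFrame.res, MvPolynomial.algHom_C]
  have hder : F.res (derForm γ θ) = MvPolynomial.C p * F.res (derForm (F.coord 0) θ)
      + MvPolynomial.C q * F.res (derForm (F.coord 1) θ) := by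
    have h5 := congrArg (fun δ => F.res (derForm δ θ)) hdecomp
    simp only [derForm_add, derForm_smul, map_add, map_mul, h4, mul_zero, add_zero] at h5
    rw [h5]
    simp [PlaneFrame.res, MvPolynomial.algHom_C]
  have hW : F.res (eulerDet F θ)
      = F.res (linPoly (F.coord 0)) * F.res (derForm (F.coord 1) θ)
        - F.res (linPoly (F.coord 1)) * F.res (derForm (F.coord 0) θ) := by
    rw [eulerDet_apply, map_sub, map_mul, map_mul]
  -- the form of the trace divides both `p` and `q` times the determinant
  have hp : linPoly (γ ∘ₗ F.e) ∣ MvPolynomial.C p * F.res (eulerDet F θ) := by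
    have : MvPolynomial.C p * F.res (eulerDet F θ)
        = linPoly (γ ∘ₗ F.e) * F.res (derForm (F.coord 1) θ)
          - F.res (linPoly (F.coord 1)) * F.res (derForm γ θ) := by
      rw [hW, hres, hder]
      ring
    rw [this]
    exact dvd_sub (Dvd.intro _ rfl) (Dvd.dvd.mul_left h3 _)
  have hq : linPoly (γ ∘ₗ F.e) ∣ MvPolynomial.C q * F.res (eulerDet F θ) := by
    have : MvPolynomial.C q * F.res (eulerDet F θ)
        = F.res (linPoly (F.coord 0)) * F.res (derForm γ θ)
          - linPoly (γ ∘ₗ F.e) * F.res (derForm (F.coord 0) θ) := by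
      rw [hW, hres, hder]
      ring
    rw [this]
    exact dvd_sub (Dvd.dvd.mul_left h3 _) (Dvd.intro _ rfl)
  by_cases hp0 : p = 0
  · have hq0 : q ≠ 0 := by
      intro hq0
      refine hγ0 (LinearMap.pi_ext' fun i => LinearMap.ext_ring ?_)
      fin_cases i
      · exact hp0
      · exact hq0
    exact (IsUnit.dvd_mul_left ((Ne.isUnit hq0).map MvPolynomial.C)).mp hq
  · exact (IsUnit.dvd_mul_left ((Ne.isUnit hp0).map MvPolynomial.C)).mp hp

/-- On a member of a free arrangement with exponents `(1, a, b)` the other members cut out at most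
`b + 1` lines: otherwise every logarithmic derivation restricts to a multiple of the Euler
derivation of the plane, as the determinant of the two has too many linear factors. -/
theorem card_traces_delete_le_of_isFree (A : HypArrangement K 3) {α : Module.Dual K (Fin 3 → K)}
    (hα : LinearMap.ker α ∈ A.planes) (F : PlaneFrame α) {a b : ℕ} (hab : a ≤ b)
    (hA : A.IsFreeWithExp ![1, a, b]) :
    ((A.delete (LinearMap.ker α)).traces F).card ≤ b + 1 := by
  by_contra! hcon
  have hα' : LinearMap.ker α ∉ (A.delete (LinearMap.ker α)).planes :=
    fun h => (mem_planes_delete.mp h).1 rfl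
  obtain ⟨hn, -⟩ := A.exponents_of_isFree hA
  have hc := A.card_planes_delete hα
  have hs := (A.delete (LinearMap.ker α)).sum_card_planesOver F
  obtain ⟨θ, hθ⟩ := hA
  have hbasis : ∀ i, F.res (eulerDet F (θ i)) = 0 := fun i => by
    have hprod := (A.delete (LinearMap.ker α)).prod_traces_dvd hα' F (fun _ => 1)
      (f := F.res (eulerDet F (θ i))) fun Y hY => by
        rw [pow_one]
        exact A.linPoly_trace_dvd_res_eulerDet hα F (θ i).2 hY
    have hprodhom := MvPolynomial.IsHomogeneous.prod ((A.delete (LinearMap.ker α)).traces F)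
      (fun Y => linPoly (planeForm Y) ^ 1) (fun _ => 1 * 1)
      fun Y _ => (linPoly_isHomogeneous (planeForm Y)).pow 1
    have hhom : (eulerDet F (θ i : Fin 3 → MvPolynomial (Fin 3) K)).IsHomogeneous
        (1 + ![1, a, b] i) := by
      rw [eulerDet_apply]
      exact ((linPoly_isHomogeneous _).mul (derForm_isHomogeneous _ (hθ i))).sub
        ((linPoly_isHomogeneous _).mul (derForm_isHomogeneous _ (hθ i)))
    refine eq_zero_of_dvd_of_degree_lt hprodhom (F.res_isHomogeneous hhom) ?_ hprod
    have hi : ![1, a, b] i ≤ b := by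
      fin_cases i
      · change 1 ≤ b
        omega
      · exact hab
      · exact le_rfl
    rw [Finset.sum_const, smul_eq_mul]
    omega
  -- a derivation of `D(A)` in a constant direction of the plane
  set w : Fin 3 → K := F.e (Pi.single 0 1) with hw
  have hαw : α w = 0 := DFunLike.congr_fun F.comp_e _
  have hmem : (A.delete (LinearMap.ker α)).defPoly • constDer w ∈ A.logDer := by
    refine (A.mem_logDer_iff_delete hα _).mpr ⟨defPoly_smul_mem_logDer _ _, ?_⟩
    rw [map_smul, derForm_constDer, hαw, map_zero, smul_zero]
    exact dvd_zero _
  have h := A.res_eq_zero_of_basis θ F (eulerDet F) hbasis hmem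
  have h0 : F.coord 0 w = 1 := by
    have := DFunLike.congr_fun (F.coord_comp_e 0) (Pi.single 0 1)
    simpa using this
  have h1 : F.coord 1 w = 0 := by
    have := DFunLike.congr_fun (F.coord_comp_e 1) (Pi.single 0 1)
    simpa using this
  have h2 : eulerDet F (constDer w) = - linPoly (F.coord 1) := by
    rw [eulerDet_apply, derForm_constDer, derForm_constDer, h0, h1]
    simp
  rw [map_smul, h2, smul_eq_mul, map_mul, map_neg, F.res_linPoly, F.coord_comp_e, linPoly_proj,
    mul_neg, neg_eq_zero, mul_eq_zero] at h
  exact h.elim (res_defPoly_ne_zero _ hα' F) (MvPolynomial.X_ne_zero _)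

end HypArrangement

theorem theorem5p3 {K : Type*} [Field K] (A : HypArrangement K 3)
    (H : Submodule K (Fin 3 → K)) (hH : H ∈ A.planes)
    (hA : A.IsIntegerRooted) (hA' : (A.delete H).IsIntegerRooted) :
    (∀ a b : ℕ, ∀ c d : ℤ, a ≤ b → c ≤ d →
      A.IsFreeWithExp ![1, a, b] →
      (A.delete H).charPoly₀ = (X - C c) * (X - C d) →
      (a : ℤ) - 1 ≤ c ∧ c ≤ d ∧ d ≤ (b : ℤ)) ∧
    (∀ a b : ℕ, ∀ c d : ℤ, a ≤ b → c ≤ d →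
      (A.delete H).IsFreeWithExp ![1, a, b] →
      A.charPoly₀ = (X - C c) * (X - C d) →
      (a : ℤ) ≤ c ∧ c ≤ d ∧ d ≤ (b : ℤ) + 1) := by
  classical
  obtain ⟨α, hα0, rfl⟩ := A.exists_form hH
  obtain ⟨F⟩ := HypArrangement.exists_planeFrame hα0
  have hα' : LinearMap.ker α ∉ (A.delete (LinearMap.ker α)).planes :=
    fun h => (HypArrangement.mem_planes_delete.mp h).1 rfl
  have hcard := A.card_planes_delete hH
  have hb2 := A.secondBetti_delete hH
  have htr := (A.delete (LinearMap.ker α)).card_traces F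
  rw [← htr] at hb2
  zify at hcard hb2
  constructor
  · intro a b c d hab hcd hfree hχ
    obtain ⟨hn, he⟩ := A.exponents_of_isFree hfree
    have hh := A.card_traces_delete_le_of_isFree hH F hab hfree
    have hne : (A.delete (LinearMap.ker α)).planes.Nonempty := by
      rw [Finset.nonempty_iff_ne_empty]
      intro h0
      -- `t² + t + 1` has no integer root
      have h1 := congrArg (eval c) ((HypArrangement.charPoly₀_of_isEmpty _ h0).symm.trans hχ)
      simp only [eval_add, eval_mul, eval_pow, eval_X, eval_one, eval_sub, eval_C, sub_self,
        zero_mul] at h1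
      nlinarith [sq_nonneg (2 * c + 1)]
    obtain ⟨h1, h2⟩ := HypArrangement.roots_charPoly₀ _ hne hχ
    zify at hn he hh hab
    have hs : c + d = a + b - 1 := by linarith
    -- the reduced characteristic polynomial of the deletion is nonnegative at `b`
    have hkey : 0 ≤ (b - c) * (b - d) := by nlinarith
    have hd : d ≤ b := by
      by_contra! hd
      nlinarith [mul_pos (show (0 : ℤ) < b - c by linarith) (sub_pos.mpr hd)]
    exact ⟨by linarith, hcd, hd⟩
  · intro a b c d hab hcd hfree hχ
    obtain ⟨hn, he⟩ := HypArrangement.exponents_of_isFree _ hfree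
    have hh := HypArrangement.lt_card_traces_of_isFree _ hα' F hab hfree
    obtain ⟨h1, h2⟩ := A.roots_charPoly₀ ⟨_, hH⟩ hχ
    zify at hn he hh hab
    have hs : c + d = a + b + 1 := by linarith
    -- the reduced characteristic polynomial of `A` is nonnegative at `b + 1`
    have hkey : 0 ≤ (b + 1 - c) * (b + 1 - d) := by nlinarith
    have hd : d ≤ b + 1 := by
      by_contra! hd
      nlinarith [mul_pos (show (0 : ℤ) < b + 1 - c by linarith) (sub_pos.mpr hd)]
    exact ⟨by linarith, hcd, hd⟩
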